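/- Let $D\subset\mathbb{C}^n$ be a bounded domain (non-empty, open, connected) and let $\varphi\in C^2(D)$ be real-valued. Let $dV$ be Lebesgue measure, and let $A^2(D,\varphi)$ be the set of holomorphic functions $f$ on $D$ with $\int_D|f|^2e^{-\varphi}\,dV<\infty$. Notation. For holomorphic functions $g=(g_1,\dots,g_k)$ on $D$ without common zeros put $|g|^2=\sum_\lambda|g_\lambda|^2$, $\beta=|g|^2\left(-\partial\frac{g_1}{|g|^2},\dots,-\partial\frac{g_k}{|g|^2}\right)=\sum_j dz_j\otimes\beta_j$, a $(1,0)$-form with values in $\operatorname{Hom}(\mathbb{C}^k,\mathbb{C})$, and let $\beta^*=\sum_j d\bar z_j\otimes\beta_j^*$ be its adjoint, where $\mathbb{C}^k$ carries the standard metric and $\mathbb{C}$ the quotient metric $|q|^2/|g|^2$; thus $\beta^*=-\bar\partial\left(\frac{\bar g_1}{|g|^2},\dots,\frac{\bar g_k}{|g|^2}\right)$ and $\beta^*\wedge\beta=-\sum_{j,l}dz_j\wedge d\bar z_l\otimes\beta_l^*\beta_j$. An $\operatorname{End}(\mathbb{C}^k)$-valued form $i\sum c_{jl\lambda\mu}\,dz_j\wedge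 d\bar z_l\otimes e_\lambda^*\otimes e_\mu$ is called $>0$ in the sense of Nakano if $\sum c_{jl\lambda\mu}u_{j\lambda}\bar u_{l\mu}>0$ at every point of $D$ for all $u=(u_{j\lambda})\neq0$. Forms are measured in the metric for which the $dz_I\wedge d\bar z_J\otimes e_\lambda$ are orthonormal, $\Lambda$ is the adjoint of $\omega\wedge\cdot$ with $\omega=i\sum_j dz_j\wedge d\bar z_j$, and $dz=dz_1\wedge\dots\wedge dz_n$. For a smooth function $\psi$ with $i\partial\bar\partial\psi\otimes\mathrm{Id}_{\mathbb{C}^k}+i\beta^*\wedge\beta>0$ in the sense of Nakano, the operator $[i\partial\bar\partial\psi\otimes\mathrm{Id}_{\mathbb{C}^k}+i\beta^*\wedge\beta,\Lambda]$ is positive definite, hence invertible, on $\mathbb{C}^k$-valued $(n,1)$-forms; put $$I_{\varphi,\psi,g}(f)=\int_D\left\{\frac1{|g|^2}+\left(\left[i\partial\bar\partial\psi\otimes\mathrm{Id}_{\mathbb{C}^k}+i\beta^*\wedge\beta,\Lambda\right]^{-1}\beta^*\wedge dz,\ \beta^*\wedge dz\right)\right\}|f|^2e^{-\varphi-\psi}\,dV\in[0,\infty].$$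 A holomorphic function $f$ on $D$ is called $L^2$ divisible with respect to $\varphi$ if for every $k$, all holomorphic functions $g=(g_1,\dots,g_k)$ on $D$ and every smooth plurisubharmonic function $\psi$ on $D$ such that (1) $g_1,\dots,g_k$ have no common zeros in $D$, (2) $i\partial\bar\partial\psi\otimes\mathrm{Id}_{\mathbb{C}^k}+i\beta^*\wedge\beta>0$ in the sense of Nakano, and (3) $I_{\varphi,\psi,g}(f)<\infty$, there are holomorphic functions $h=(h_1,\dots,h_k)$ on $D$ with $$f=g_1h_1+\dots+g_kh_k\quad\text{and}\quad\int_D|h|^2e^{-\varphi-\psi}\,dV\le I_{\varphi,\psi,g}(f),\qquad |h|^2=\sum_\lambda|h_\lambda|^2.$$ Theorem. If there exists some non-zero $f\in A^2(D,\varphi)$ which is $L^2$ divisible with respect to $\varphi$, then $\varphi$ is plurisubharmonic on $D$. -/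

import Mathlib

open MeasureTheory

namespace SkodaDivision

noncomputable section

/-! ### Functions on domains of `ℂⁿ` -/

/-- A domain of `ℂⁿ`: a non-empty connected open set. -/
def IsDomainIn {n : ℕ} (D : Set (Fin n → ℂ)) : Prop := IsOpen D ∧ IsConnected D

/-- Plurisubharmonicity of a real-valued function on an open set `D ⊆ ℂⁿ`: upper semicontinuity and
the sub-mean value inequality on every closed complex disc `{a + ζ w : |ζ| ≤ 1}` contained in `D`.
(For a real-valued function the mean cannot be `-∞`, which is the integrability clause.) -/
def IsPSH {n : ℕ} (D : Set (Fin n → ℂ)) (φ : (Fin n → ℂ) → ℝ) : Prop :=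
  UpperSemicontinuousOn φ D ∧
    ∀ a w : Fin n → ℂ, (∀ ζ : ℂ, ‖ζ‖ ≤ 1 → a + ζ • w ∈ D) →
      CircleIntegrable (fun ζ : ℂ => φ (a + ζ • w)) 0 1 ∧
        φ a ≤ Real.circleAverage (fun ζ : ℂ => φ (a + ζ • w)) 0 1

/-- The weighted Bergman space `A²(D, φ)`: holomorphic functions on `D` with
`∫_D |f|² e^{-φ} dV < ∞`. -/
def bergmanSpace {n : ℕ} (D : Set (Fin n → ℂ)) (φ : (Fin n → ℂ) → ℝ) :
    Set ((Fin n → ℂ) → ℂ) :=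
  {f | DifferentiableOn ℂ f D ∧
    ∫⁻ z in D, ENNReal.ofReal (‖f z‖ ^ 2 * Real.exp (-φ z)) < ⊤}

/-- The Wirtinger derivative `∂u/∂z_j = ½ (∂u/∂x_j - i ∂u/∂y_j)`. -/
def dz {n : ℕ} (j : Fin n) (u : (Fin n → ℂ) → ℂ) (z : Fin n → ℂ) : ℂ :=
  (1 / 2 : ℂ) * (fderiv ℝ u z (Pi.single j 1) - Complex.I * fderiv ℝ u z (Pi.single j Complex.I))

/-- The Wirtinger derivative `∂u/∂z̄_j = ½ (∂u/∂x_j + i ∂u/∂y_j)`. -/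
def dzbar {n : ℕ} (j : Fin n) (u : (Fin n → ℂ) → ℂ) (z : Fin n → ℂ) : ℂ :=
  (1 / 2 : ℂ) * (fderiv ℝ u z (Pi.single j 1) + Complex.I * fderiv ℝ u z (Pi.single j Complex.I))

/-- The coefficients `∂²ψ/∂z_j∂z̄_l` of `∂∂̄ψ = ∑ ψ_{j l̄} dz_j ∧ dz̄_l`. -/
def ddbar {n : ℕ} (ψ : (Fin n → ℂ) → ℝ) (z : Fin n → ℂ) (j l : Fin n) : ℂ :=
  dz j (dzbar l (fun w => (ψ w : ℂ))) z

/-! ### The second fundamental form of the kernel of `g : ℂᵏ → ℂ` -/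

/-- `|g|² = |g₁|² + ⋯ + |g_k|²`. -/
def normSqTuple {n k : ℕ} (g : Fin k → (Fin n → ℂ) → ℂ) (z : Fin n → ℂ) : ℝ :=
  ∑ lam, ‖g lam z‖ ^ 2

/-- The second fundamental form `β = |g|² (-∂(g₁/|g|²), …, -∂(g_k/|g|²))`: the coefficient
`β_{jλ}` of `dz_j` in its `λ`-th entry. -/
def beta {n k : ℕ} (g : Fin k → (Fin n → ℂ) → ℂ) (z : Fin n → ℂ) (j : Fin n) (lam : Fin k) : ℂ :=
  (normSqTuple g z : ℂ) * -(dz j (fun w => g lam w / (normSqTuple g w : ℂ)) z)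

/-- The adjoint `β* = ∑ dz̄_l ⊗ β_l*` of `β = ∑ dz_l ⊗ β_l`, where `ℂᵏ` has the standard metric and
the quotient `ℂ` has the quotient metric `|q|² / |g|²`: the coefficient `β*_{lμ}` of `dz̄_l ⊗ e_μ`
in `β*(1)`. -/
def betaStar {n k : ℕ} (g : Fin k → (Fin n → ℂ) → ℂ) (z : Fin n → ℂ) (l : Fin n) (mu : Fin k) :
    ℂ :=
  (starRingEnd ℂ) (beta g z l mu) / (normSqTuple g z : ℂ)

/-- `β* = -∂̄(g*)` with `g* = (ḡ₁, …, ḡ_k) / |g|²`. -/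
lemma betaStar_eq {n k : ℕ} (g : Fin k → (Fin n → ℂ) → ℂ) (z : Fin n → ℂ) (l : Fin n)
    (mu : Fin k) (hz : normSqTuple g z ≠ 0) :
    betaStar g z l mu =
      -dzbar l (fun w => (starRingEnd ℂ) (g mu w) / (normSqTuple g w : ℂ)) z := by
  have h1 : (fun w => (starRingEnd ℂ) (g mu w) / (normSqTuple g w : ℂ)) =
      Complex.conjCLE ∘ fun w => g mu w / (normSqTuple g w : ℂ) := by
    funext w; simp
  have hz' : (normSqTuple g z : ℂ) ≠ 0 := by exact_mod_cast hz
  simp only [betaStar, beta, dzbar, dz, h1]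
  rw [Complex.conjCLE.comp_fderiv]
  have h2 : (starRingEnd ℂ) (2 : ℂ) = 2 := map_ofNat _ 2
  simp only [map_mul, map_neg, map_sub, map_div₀, map_one, Complex.conj_I, Complex.conj_ofReal, h2,
    ContinuousLinearMap.comp_apply, ContinuousLinearEquiv.coe_coe, Complex.conjCLE_apply]
  field_simp
  ring

/-! ### `(1,1)`-forms with values in `End(ℂᵏ)`

Such a form `∑ c_{jlλμ} dz_j ∧ dz̄_l ⊗ e_λ* ⊗ e_μ` at a point is given by its coefficients
`c j l λ μ`. -/

/-- Coefficients at a point of an `End(ℂᵏ)`-valued `(1,1)`-form on `ℂⁿ`. -/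
abbrev EndForm (n k : ℕ) : Type := Fin n → Fin n → Fin k → Fin k → ℂ

/-- `∂∂̄ψ ⊗ Id`. -/
def ddbarId {n : ℕ} (k : ℕ) (ψ : (Fin n → ℂ) → ℝ) (z : Fin n → ℂ) : EndForm n k :=
  fun j l lam mu => if lam = mu then ddbar ψ z j l else 0

/-- `β* ∧ β = - ∑ dz_j ∧ dz̄_l ⊗ β_l* β_j`. -/
def betaStarWedgeBeta {n k : ℕ} (g : Fin k → (Fin n → ℂ) → ℂ) (z : Fin n → ℂ) : EndForm n k :=
  fun j l lam mu => -(betaStar g z l mu * beta g z j lam)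

/-- `i c > 0` in the sense of Nakano:
`∑ c_{jlλμ} u_{jλ} conj(u_{lμ}) > 0` for every non-zero `u ∈ T ⊗ ℂᵏ`. -/
def NakanoPos {n k : ℕ} (c : EndForm n k) : Prop :=
  ∀ u : Fin n → Fin k → ℂ, u ≠ 0 →
    0 < (∑ j, ∑ l, ∑ lam, ∑ mu, c j l lam mu * u j lam * (starRingEnd ℂ) (u l mu)).re

/-! ### `ℂᵏ`-valued differential forms at a point and the operator `[i c, Λ]` -/

/-- `ℂᵏ`-valued forms `∑ u_{IJλ} dz_I ∧ dz̄_J ⊗ e_λ` at a point (all bidegrees, `I` and `J` in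
increasing order), with the metric in which the `dz_I ∧ dz̄_J ⊗ e_λ` are orthonormal. -/
abbrev FormAt (n k : ℕ) : Type :=
  EuclideanSpace ℂ (Finset (Fin n) × Finset (Fin n) × Fin k)

/-- `u ↦ dz_j ∧ u`. -/
def wedgeDz {n k : ℕ} (j : Fin n) : FormAt n k →ₗ[ℂ] FormAt n k where
  toFun u := WithLp.toLp 2 fun p =>
    if j ∈ p.1 then (-1) ^ (p.1.filter (· < j)).card * u (p.1.erase j, p.2.1, p.2.2) else 0
  map_add' u v := by
    ext p; by_cases h : j ∈ p.1 <;> simp [h, mul_add]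
  map_smul' a u := by
    ext p; by_cases h : j ∈ p.1 <;> simp [h, mul_left_comm]

/-- `u ↦ dz̄_j ∧ u`. -/
def wedgeDzbar {n k : ℕ} (j : Fin n) : FormAt n k →ₗ[ℂ] FormAt n k where
  toFun u := WithLp.toLp 2 fun p =>
    if j ∈ p.2.1 then
      (-1) ^ (p.1.card + (p.2.1.filter (· < j)).card) * u (p.1, p.2.1.erase j, p.2.2)
    else 0
  map_add' u v := by
    ext p; by_cases h : j ∈ p.2.1 <;> simp [h, mul_add]
  map_smul' a u := by
    ext p; by_cases h : j ∈ p.2.1 <;> simp [h, mul_left_comm]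

/-- The action on values of the endomorphism `∑ M_{λμ} e_λ* ⊗ e_μ` of `ℂᵏ`. -/
def endAct {n k : ℕ} (M : Fin k → Fin k → ℂ) : FormAt n k →ₗ[ℂ] FormAt n k where
  toFun u := WithLp.toLp 2 fun p => ∑ lam, M lam p.2.2 * u (p.1, p.2.1, lam)
  map_add' u v := by
    ext p; simp [mul_add, Finset.sum_add_distrib]
  map_smul' a u := by
    ext p; simp [Finset.mul_sum, mul_left_comm]

/-- `u ↦ i c ∧ u` for an `End(ℂᵏ)`-valued `(1,1)`-form `c`. -/
def wedgeEnd {n k : ℕ} (c : EndForm n k) : Module.End ℂ (FormAt n k) :=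
  Complex.I • ∑ j, ∑ l, wedgeDz j ∘ₗ wedgeDzbar l ∘ₗ endAct (c j l)

/-- `L = ω ∧ ·` with `ω = i ∑ dz_j ∧ dz̄_j`. -/
def lefschetz (n k : ℕ) : Module.End ℂ (FormAt n k) :=
  Complex.I • ∑ j, wedgeDz j ∘ₗ wedgeDzbar j

/-- `Λ`, the adjoint of `L`. -/
def lefschetzAdj (n k : ℕ) : Module.End ℂ (FormAt n k) :=
  LinearMap.adjoint (lefschetz n k)

/-- The isometric embedding `(u_{jλ}) ↦ ∑ u_{jλ} dz ∧ dz̄_j ⊗ e_λ` onto the `(n,1)`-forms, where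
`dz = dz₁ ∧ ⋯ ∧ dz_n`. -/
def formN1 (n k : ℕ) : EuclideanSpace ℂ (Fin n × Fin k) →ₗ[ℂ] FormAt n k where
  toFun u := ∑ j, ∑ lam, u (j, lam) • EuclideanSpace.single (Finset.univ, {j}, lam) (1 : ℂ)
  map_add' u v := by simp [add_smul, Finset.sum_add_distrib]
  map_smul' a u := by simp [Finset.smul_sum, smul_smul]

/-- The operator `[i c, Λ]` on `ℂᵏ`-valued `(n,1)`-forms, in the orthonormal coordinates `u_{jλ}`.
(The commutator preserves bidegrees, so composing with the adjoint of the embedding only reads off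
the coordinates.) -/
def curvOp {n k : ℕ} (c : EndForm n k) : Module.End ℂ (EuclideanSpace ℂ (Fin n × Fin k)) :=
  LinearMap.adjoint (formN1 n k) ∘ₗ ⁅wedgeEnd c, lefschetzAdj n k⁆ ∘ₗ formN1 n k

lemma wedgeDz_apply {n k : ℕ} (j : Fin n) (u : FormAt n k) (p) :
    wedgeDz j u p =
      if j ∈ p.1 then (-1) ^ (p.1.filter (· < j)).card * u (p.1.erase j, p.2.1, p.2.2) else 0 := rfl

lemma wedgeDzbar_apply {n k : ℕ} (j : Fin n) (u : FormAt n k) (p) :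
    wedgeDzbar j u p =
      if j ∈ p.2.1 then
        (-1) ^ (p.1.card + (p.2.1.filter (· < j)).card) * u (p.1, p.2.1.erase j, p.2.2)
      else 0 := rfl

lemma endAct_apply {n k : ℕ} (M : Fin k → Fin k → ℂ) (u : FormAt n k) (p) :
    endAct M u p = ∑ lam, M lam p.2.2 * u (p.1, p.2.1, lam) := rfl

lemma wedgeDz_single {n k : ℕ} (j : Fin n) (I J : Finset (Fin n)) (lam : Fin k) :
    wedgeDz j (EuclideanSpace.single (I, J, lam) (1 : ℂ) : FormAt n k) =
      if j ∈ I then 0 else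
        ((-1 : ℂ) ^ (I.filter (· < j)).card) • EuclideanSpace.single (insert j I, J, lam) 1 := by
  ext ⟨I', J', mu⟩
  rw [wedgeDz_apply]
  by_cases hI : j ∈ I
  · simp only [hI, if_true]
    have : I'.erase j ≠ I := by rintro rfl; simp at hI
    simp [this]
  · simp only [hI, if_false]
    by_cases hI' : j ∈ I'
    · simp only [hI', if_true]
      by_cases h : I'.erase j = I
      · have h2 : I' = insert j I := by rw [← h, Finset.insert_erase hI']
        subst h2
        simp [Finset.filter_insert, hI]
      · have h2 : I' ≠ insert j I := by
          rintro rfl; simp [hI] at h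
        simp [h, h2]
    · have h2 : I' ≠ insert j I := by rintro rfl; simp at hI'
      simp [hI', h2]

lemma wedgeDzbar_single {n k : ℕ} (j : Fin n) (I J : Finset (Fin n)) (lam : Fin k) :
    wedgeDzbar j (EuclideanSpace.single (I, J, lam) (1 : ℂ) : FormAt n k) =
      if j ∈ J then 0 else
        ((-1 : ℂ) ^ (I.card + (J.filter (· < j)).card)) •
          EuclideanSpace.single (I, insert j J, lam) 1 := by
  ext ⟨I', J', mu⟩
  rw [wedgeDzbar_apply]
  by_cases hI : j ∈ J
  · simp only [hI, if_true]
    have : J'.erase j ≠ J := by rintro rfl; simp at hI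
    simp [this]
  · simp only [hI, if_false]
    by_cases hI' : j ∈ J'
    · simp only [hI', if_true]
      by_cases h : J'.erase j = J
      · have h2 : J' = insert j J := by rw [← h, Finset.insert_erase hI']
        subst h2
        by_cases h3 : I' = I
        · subst h3; simp [Finset.filter_insert, hI]
        · simp [h3]
      · have h2 : J' ≠ insert j J := by
          rintro rfl; simp [hI] at h
        simp [h, h2]
    · have h2 : J' ≠ insert j J := by rintro rfl; simp at hI'
      simp [hI', h2]

lemma endAct_single {n k : ℕ} (M : Fin k → Fin k → ℂ) (I J : Finset (Fin n)) (lam : Fin k) :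
    endAct M (EuclideanSpace.single (I, J, lam) (1 : ℂ) : FormAt n k) =
      ∑ mu, M lam mu • EuclideanSpace.single (I, J, mu) 1 := by
  ext ⟨I', J', mu⟩
  rw [endAct_apply]
  by_cases h1 : I' = I <;> by_cases h2 : J' = J <;>
    simp [h1, h2, Pi.single_apply]

lemma lefschetzAdj_single {n k : ℕ} (j : Fin n) (lam : Fin k) :
    lefschetzAdj n k (EuclideanSpace.single (Finset.univ, {j}, lam) (1 : ℂ)) =
      (-Complex.I * (-1) ^ (Finset.univ.filter (· < j)).card *
        (-1) ^ (Finset.univ.erase j).card) •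
        EuclideanSpace.single (Finset.univ.erase j, ∅, lam) 1 := by
  refine ext_inner_left ℂ fun x => ?_
  rw [lefschetzAdj, LinearMap.adjoint_inner_right, inner_smul_right]
  simp only [EuclideanSpace.inner_single_right]
  simp only [lefschetz, LinearMap.smul_apply, LinearMap.sum_apply, LinearMap.comp_apply]
  simp only [PiLp.smul_apply, WithLp.ofLp_sum, Finset.sum_apply, wedgeDz_apply, wedgeDzbar_apply]
  rw [Finset.sum_eq_single j]
  · have h : (({j} : Finset (Fin n)).filter (· < j)).card = 0 := by
      rw [Finset.card_eq_zero]; ext i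
      simp only [Finset.mem_filter, Finset.mem_singleton, Finset.notMem_empty, iff_false]
      rintro ⟨rfl, h⟩; exact lt_irrefl _ h
    simp [h, mul_assoc]
  · intro b _ hb; simp [hb]
  · simp

lemma wedgeEnd_single {n k : ℕ} (c : EndForm n k) (j : Fin n) (lam : Fin k) :
    wedgeEnd c (EuclideanSpace.single (Finset.univ.erase j, ∅, lam) (1 : ℂ)) =
      (Complex.I * (-1) ^ (Finset.univ.filter (· < j)).card *
        (-1) ^ (Finset.univ.erase j).card) •
        ∑ l, ∑ mu, c j l lam mu • EuclideanSpace.single (Finset.univ, {l}, mu) 1 := by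
  simp only [wedgeEnd, LinearMap.smul_apply, LinearMap.sum_apply, LinearMap.comp_apply,
    endAct_single, map_sum, map_smul, wedgeDzbar_single]
  rw [Finset.sum_eq_single j]
  · have h : (Finset.univ.erase j).filter (· < j) = Finset.univ.filter (· < j) := by
      ext i; simp only [Finset.mem_filter, Finset.mem_erase, Finset.mem_univ]
      constructor
      · tauto
      · rintro ⟨_, h⟩; exact ⟨⟨h.ne, trivial⟩, h⟩
    simp only [mul_smul, Finset.smul_sum]
    refine Finset.sum_congr rfl fun l _ => Finset.sum_congr rfl fun mu _ => ?_
    simp [wedgeDz_single, h, smul_smul]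
    ring_nf
  · intro b _ hb
    simp [wedgeDz_single, hb]
  · simp

lemma wedgeEnd_single_univ {n k : ℕ} (c : EndForm n k) (j : Fin n) (lam : Fin k) :
    wedgeEnd c (EuclideanSpace.single (Finset.univ, {j}, lam) (1 : ℂ)) = 0 := by
  simp only [wedgeEnd, LinearMap.smul_apply, LinearMap.sum_apply, LinearMap.comp_apply,
    endAct_single, map_sum, map_smul, wedgeDzbar_single]
  refine smul_eq_zero_of_right _ (Finset.sum_eq_zero fun a _ => Finset.sum_eq_zero fun b _ =>
    Finset.sum_eq_zero fun d _ => ?_)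
  split_ifs <;> simp [wedgeDz_single]

lemma formN1_apply {n k : ℕ} (u : EuclideanSpace ℂ (Fin n × Fin k)) :
    formN1 n k u =
      ∑ j, ∑ lam, u (j, lam) • EuclideanSpace.single (Finset.univ, {j}, lam) (1 : ℂ) := rfl

/-- The commutator maps `(n,1)`-forms to `(n,1)`-forms, and is given by the coefficients of `c`. -/
lemma commutator_formN1 {n k : ℕ} (c : EndForm n k) (u : EuclideanSpace ℂ (Fin n × Fin k)) :
    ⁅wedgeEnd c, lefschetzAdj n k⁆ (formN1 n k u) =
      formN1 n k (WithLp.toLp 2 fun p => ∑ j, ∑ lam, c j p.1 lam p.2 * u (j, lam)) := by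
  have key : ∀ (j : Fin n) (lam : Fin k), ⁅wedgeEnd c, lefschetzAdj n k⁆
      (EuclideanSpace.single (Finset.univ, {j}, lam) (1 : ℂ)) =
        ∑ l, ∑ mu, c j l lam mu • EuclideanSpace.single (Finset.univ, {l}, mu) (1 : ℂ) := by
    intro j lam
    rw [Ring.lie_def, LinearMap.sub_apply, Module.End.mul_apply, Module.End.mul_apply,
      wedgeEnd_single_univ, map_zero, sub_zero, lefschetzAdj_single, map_smul, wedgeEnd_single,
      smul_smul]
    have h1 : ∀ m : ℕ, ((-1 : ℂ) ^ m) * (-1) ^ m = 1 := fun m => by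
      rw [← mul_pow]; simp
    have h2 : ∀ a b : ℂ, a * a = 1 → b * b = 1 →
        -Complex.I * a * b * (Complex.I * a * b) = 1 := by
      intro a b ha hb
      linear_combination (-(Complex.I * Complex.I) * (b * b)) * ha
        + (-(Complex.I * Complex.I)) * hb - Complex.I_mul_I
    rw [h2 _ _ (h1 _) (h1 _), one_smul]
  simp only [formN1_apply, map_sum, map_smul, key, Finset.smul_sum, Finset.sum_smul, smul_smul]
  rw [Finset.sum_congr rfl fun j _ => Finset.sum_comm, Finset.sum_comm]
  refine Finset.sum_congr rfl fun l _ => ?_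
  rw [Finset.sum_congr rfl fun j _ => Finset.sum_comm, Finset.sum_comm]
  refine Finset.sum_congr rfl fun mu _ => Finset.sum_congr rfl fun j _ =>
    Finset.sum_congr rfl fun lam _ => ?_
  rw [mul_comm]

lemma adjoint_formN1 {n k : ℕ} (u : EuclideanSpace ℂ (Fin n × Fin k)) :
    LinearMap.adjoint (formN1 n k) (formN1 n k u) = u := by
  refine ext_inner_left ℂ fun x => ?_
  rw [LinearMap.adjoint_inner_right]
  conv_lhs => rw [formN1_apply u]
  simp only [inner_sum, inner_smul_right, EuclideanSpace.inner_single_right]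
  simp only [PiLp.inner_apply, Fintype.sum_prod_type]
  refine Finset.sum_congr rfl fun j _ => Finset.sum_congr rfl fun lam _ => ?_
  have : formN1 n k x (Finset.univ, {j}, lam) = x (j, lam) := by
    simp [formN1_apply, Pi.single_apply, Finset.sum_ite_eq, ite_and]
  simp [this]

/-- In coordinates, `⟨[i c, Λ] u, v⟩ = ∑ c_{jlλμ} u_{jλ} conj(v_{lμ})`. -/
lemma curvOp_apply {n k : ℕ} (c : EndForm n k) (u : EuclideanSpace ℂ (Fin n × Fin k))
    (p : Fin n × Fin k) :
    curvOp c u p = ∑ j, ∑ lam, c j p.1 lam p.2 * u (j, lam) := by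
  simp only [curvOp, LinearMap.comp_apply]
  rw [commutator_formN1, adjoint_formN1]

/-- The coordinates of the `(n,1)`-form `β* ∧ dz = ∑ β*_{lμ} dz̄_l ∧ dz ⊗ e_μ`, where
`dz̄_l ∧ dz = (-1)ⁿ dz ∧ dz̄_l`. -/
def betaStarDz {n k : ℕ} (g : Fin k → (Fin n → ℂ) → ℂ) (z : Fin n → ℂ) :
    EuclideanSpace ℂ (Fin n × Fin k) :=
  WithLp.toLp 2 fun p => (-1) ^ n * betaStar g z p.1 p.2

/-! ### `L²` divisibility -/

/-- `∂∂̄ψ ⊗ Id + β* ∧ β` at the point `z`. -/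
def curvForm {n k : ℕ} (ψ : (Fin n → ℂ) → ℝ) (g : Fin k → (Fin n → ℂ) → ℂ) (z : Fin n → ℂ) :
    EndForm n k :=
  ddbarId k ψ z + betaStarWedgeBeta g z

/-- `1/|g|² + ([i∂∂̄ψ ⊗ Id + iβ* ∧ β, Λ]⁻¹ β* ∧ dz, β* ∧ dz)` at the point `z`. -/
def skodaDensity {n k : ℕ} (ψ : (Fin n → ℂ) → ℝ) (g : Fin k → (Fin n → ℂ) → ℂ) (z : Fin n → ℂ) :
    ℝ :=
  1 / normSqTuple g z +
    (inner ℂ (betaStarDz g z) (Ring.inverse (curvOp (curvForm ψ g z)) (betaStarDz g z))).re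

/-- `I_{φ,ψ,g}(f)`, as an extended non-negative number. -/
def skodaIntegral {n k : ℕ} (D : Set (Fin n → ℂ)) (φ ψ : (Fin n → ℂ) → ℝ)
    (g : Fin k → (Fin n → ℂ) → ℂ) (f : (Fin n → ℂ) → ℂ) : ENNReal :=
  ∫⁻ z in D, ENNReal.ofReal (skodaDensity ψ g z * ‖f z‖ ^ 2 * Real.exp (-φ z - ψ z))

/-- The holomorphic function `f` on `D` is `L²` divisible with respect to `φ`. -/
def IsL2Divisible {n : ℕ} (D : Set (Fin n → ℂ)) (φ : (Fin n → ℂ) → ℝ) (f : (Fin n → ℂ) → ℂ) :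
    Prop :=
  DifferentiableOn ℂ f D ∧
  ∀ (k : ℕ) (g : Fin k → (Fin n → ℂ) → ℂ) (ψ : (Fin n → ℂ) → ℝ),
    (∀ lam, DifferentiableOn ℂ (g lam) D) →
    ContDiffOn ℝ ((⊤ : ℕ∞) : WithTop ℕ∞) ψ D →
    IsPSH D ψ →
    (∀ z ∈ D, ∃ lam, g lam z ≠ 0) →
    (∀ z ∈ D, NakanoPos (curvForm ψ g z)) →
    skodaIntegral D φ ψ g f < ⊤ →
    ∃ h : Fin k → (Fin n → ℂ) → ℂ,
      (∀ lam, DifferentiableOn ℂ (h lam) D) ∧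
      (∀ z ∈ D, f z = ∑ lam, g lam z * h lam z) ∧
      ∫⁻ z in D, ENNReal.ofReal (normSqTuple h z * Real.exp (-φ z - ψ z)) ≤
        skodaIntegral D φ ψ g f

end

end SkodaDivision

/-! Suppose the Levi form of `φ` in a direction `ξ` is at most `-c < 0` near a point `a`.
Divisibility is applied to the pair `g = (1, εp)` with `p = ∑ ξ̄_j (z_j - a_j)` and to the weight `ψ
= s|z - a|²`; write `N = |ξ|²` and `Φ = φ + ψ`.

For this pair `β` is a decomposable tensor, so the curvature operator is `s` minus an operator of
rank one and is inverted by hand. The Skoda density is at most `1 - ε²|p|² + ε⁴|p|⁴ + ε²N/(s - ε²N)`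
(`skodaDensity_linPair_le`). Write `f = h₀ + εp h₁` and `u = h₁/ε - p̄f`. On expanding `|h₀|² +
|h₁|²`, the terms `|f|²` and `-ε²|p|²|f|²` cancel against the density, and division by `ε²` leaves
`∫|u|²e^{-Φ} ≤ (N/s + o(1)) ∫|f|²e^{-Φ}` for a solution of `∂̄_ξ u = -N f` (`exists_dbar_solution`).
This is the Hörmander bound for the curvature of `ψ` alone, as if `φ` contributed nothing negative.

Now test `u` against `η = χf` with a cut-off `χ` (`cutoff_duality`) and compute the norm of the
adjoint derivative of `η` by the Bochner–Kodaira identity (`bochnerKodaira`), where the negative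
Levi form of `φ` enters. As `ε → 0` this gives `(sN + c) ∫χ|f|²e^{-Φ} ≤ sN ∫_D|f|²e^{-Φ} + ∫|∂̄_ξ
η|²e^{-Φ}` (`levi_inequality`). The weight `e^{-ψ}` concentrates at `a`. The two `sN` terms differ
only away from `a`, where the last integrand also lives, so both contributions are `O(s e^{-sr²})`;
the surviving `c ∫χ|f|²e^{-Φ}` is at least a positive constant times `e^{-sr²/2}`, since `f`
vanishes on no ball (`exp_bound_of_leviForm_neg`). Large `s` is a contradiction.

Hence the Levi form is non-negative, and a polar-coordinate divergence argument turns this into the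
sub-mean value inequality (`isPSH_of_leviForm_nonneg`). The same lemma shows that `ψ` is an
admissible weight. -/

open MeasureTheory

namespace SkodaDivision

/-! ### Holomorphic functions of several variables: smoothness and the identity theorem -/

section

open Set Filter Topology Metric

/-- Directional derivatives of a holomorphic function of several variables are holomorphic. -/
lemma differentiableOn_fderiv_apply {n : ℕ} {U : Set (Fin n → ℂ)} (hU : IsOpen U)
    {f : (Fin n → ℂ) → ℂ} (hf : DifferentiableOn ℂ f U) (v : Fin n → ℂ) :
    DifferentiableOn ℂ (fun z => fderiv ℂ f z v) U := by
  intro z₀ hz₀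
  obtain ⟨δ, hδ, hball⟩ : ∃ δ > 0, ball z₀ δ ⊆ U ∩ {z | dist (f z) (f z₀) < 1} := by
    refine Metric.mem_nhds_iff.1 (inter_mem (hU.mem_nhds hz₀) ?_)
    exact ((hf.differentiableAt (hU.mem_nhds hz₀)).continuousAt) (ball_mem_nhds _ one_pos)
  -- Nested radii: a point within `R` of `z₀`, moved by `ζ • v` with `|ζ| ≤ ρ`, stays within `2R`,
  -- and the ball of radius `2R` about it stays within `4R`. There any two values of `f` differ by
  -- less than `2`, which bounds `fderiv ℂ f` uniformly.
  obtain ⟨R, hR, rfl⟩ : ∃ R > 0, δ = 4 * R := ⟨δ / 4, by positivity, by ring⟩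
  set ρ : ℝ := R / (‖v‖ + 1) with hρ
  have hρ0 : 0 < ρ := by positivity
  have hρv : ρ * ‖v‖ < R := by
    rw [hρ, div_mul_eq_mul_div, div_lt_iff₀ (by positivity)]
    nlinarith [norm_nonneg v]
  have hmem : ∀ z ∈ ball z₀ R, ∀ ζ : ℂ, ‖ζ‖ ≤ ρ → z + ζ • v ∈ ball z₀ (2 * R) := by
    intro z hz ζ hζ
    rw [mem_ball, dist_eq_norm] at hz ⊢
    calc ‖z + ζ • v - z₀‖ = ‖(z - z₀) + ζ • v‖ := by congr 1; abel
      _ ≤ ‖z - z₀‖ + ‖ζ‖ * ‖v‖ := (norm_add_le _ _).trans (by rw [norm_smul])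
      _ < R + R := add_lt_add_of_lt_of_le hz
          ((mul_le_mul_of_nonneg_right hζ (norm_nonneg v)).trans hρv.le)
      _ = 2 * R := by ring
  have hsub : ball z₀ (2 * R) ⊆ U := fun z hz =>
    (hball (ball_subset_ball (by linarith) hz)).1
  have hdiff : ∀ z ∈ ball z₀ (2 * R), DifferentiableAt ℂ f z := fun z hz =>
    hf.differentiableAt (hU.mem_nhds (hsub hz))
  have hbound : ∀ z ∈ ball z₀ (2 * R), ‖fderiv ℂ f z‖ ≤ 2 / (2 * R) := by
    intro z hz
    have hs : ball z (2 * R) ⊆ ball z₀ (4 * R) := by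
      refine ball_subset_ball' ?_
      rw [mem_ball] at hz
      linarith
    refine Complex.norm_fderiv_le_div_of_mapsTo_ball
      (hf.mono fun x hx => (hball (hs hx)).1) ?_ (by positivity)
    intro x hx
    have h1 : dist (f x) (f z₀) < 1 := (hball (hs hx)).2
    have h2 : dist (f z) (f z₀) < 1 := (hball (hs (mem_ball_self (by positivity)))).2
    rw [mem_closedBall]
    linarith [dist_triangle_right (f x) (f z) (f z₀)]
  -- Cauchy's formula for the derivative at `0` of `ζ ↦ f (z + ζ • v)`. The right side involves only
  -- values of `f`, so it can be differentiated in `z` under the integral sign.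
  have hline : ∀ z ∈ ball z₀ R, fderiv ℂ f z v =
      (2 * Real.pi * Complex.I : ℂ)⁻¹ • ∮ ζ in C(0, ρ), ((ζ - 0) ^ 2)⁻¹ • f (z + ζ • v) := by
    intro z hz
    have h0 : ∀ ζ : ℂ, HasDerivAt (fun ζ : ℂ => z + ζ • v) v ζ := fun ζ => by
      simpa using ((hasDerivAt_id ζ).smul_const v).const_add z
    have hUo : IsOpen ((fun ζ : ℂ => z + ζ • v) ⁻¹' ball z₀ (2 * R)) :=
      isOpen_ball.preimage (by fun_prop)
    rw [Complex.two_pi_I_inv_smul_circleIntegral_sub_sq_inv_smul_of_differentiable hUo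
      (f := fun ζ : ℂ => f (z + ζ • v)) ?_ ?_ (mem_ball_self hρ0)]
    · have h2 : HasFDerivAt f (fderiv ℂ f z) (z + (0 : ℂ) • v) := by
        rw [zero_smul, add_zero]
        exact (hdiff z (ball_subset_ball (by linarith) hz)).hasFDerivAt
      exact (h2.comp_hasDerivAt (0 : ℂ) (h0 0)).deriv.symm
    · intro ζ hζ
      exact hmem z hz ζ (by simpa using hζ)
    · intro ζ hζ
      exact ((hdiff _ hζ).comp ζ (h0 ζ).differentiableAt).differentiableWithinAt
  have hcont : ∀ z ∈ ball z₀ R,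
      Continuous fun θ : ℝ => f (z + circleMap 0 ρ θ • v) := by
    intro z hz
    rw [continuous_iff_continuousAt]
    intro θ
    have h1 := (hdiff _ (hmem z hz (circleMap 0 ρ θ) (by simp [abs_of_pos hρ0]))).continuousAt
    exact ContinuousAt.comp (f := fun θ : ℝ => z + circleMap 0 ρ θ • v) h1
      (by have := continuous_circleMap 0 ρ; fun_prop)
  set c : ℝ → ℂ := fun θ => deriv (circleMap 0 ρ) θ * ((circleMap 0 ρ θ - 0) ^ 2)⁻¹ with hc
  have hcc : Continuous c := by
    have h1 := continuous_circleMap 0 ρ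
    have h2 : ∀ θ, circleMap 0 ρ θ - 0 ≠ 0 := fun θ => by
      simpa using circleMap_ne_center hρ0.ne' (c := 0) (θ := θ)
    have h3 : Continuous (deriv (circleMap 0 ρ)) := by
      simp only [funext (deriv_circleMap 0 ρ)]
      fun_prop
    exact h3.mul (((h1.sub continuous_const).pow 2).inv₀ fun θ => pow_ne_zero 2 (h2 θ))
  have hint : HasFDerivAt
      (fun z => ∫ θ in (0 : ℝ)..2 * Real.pi, c θ * f (z + circleMap 0 ρ θ • v))
      (∫ θ in (0 : ℝ)..2 * Real.pi, c θ • fderiv ℂ f (z₀ + circleMap 0 ρ θ • v)) z₀ := by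
    refine intervalIntegral.hasFDerivAt_integral_of_dominated_of_fderiv_le
      (F' := fun z θ => c θ • fderiv ℂ f (z + circleMap 0 ρ θ • v))
      (bound := fun θ => ‖c θ‖ * (2 / (2 * R))) (ball_mem_nhds z₀ hR) ?_ ?_ ?_ ?_ ?_ ?_
    · filter_upwards [ball_mem_nhds z₀ hR] with z hz
      exact (hcc.mul (hcont z hz)).aestronglyMeasurable
    · exact (hcc.mul (hcont z₀ (mem_ball_self hR))).intervalIntegrable _ _
    · refine AEStronglyMeasurable.smul hcc.aestronglyMeasurable ?_
      refine Measurable.aestronglyMeasurable ?_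
      refine (measurable_fderiv ℂ f).comp (Continuous.measurable ?_)
      have := continuous_circleMap 0 ρ
      fun_prop
    · refine Eventually.of_forall fun θ _ z hz => ?_
      rw [norm_smul]
      exact mul_le_mul_of_nonneg_left
        (hbound _ (hmem z hz _ (by simp [abs_of_pos hρ0]))) (norm_nonneg _)
    · exact (hcc.norm.mul continuous_const).intervalIntegrable _ _
    · refine Eventually.of_forall fun θ _ z hz => ?_
      have h1 := (hdiff _ (hmem z hz (circleMap 0 ρ θ) (by simp [abs_of_pos hρ0]))).hasFDerivAt
      have h2 := h1.comp z ((hasFDerivAt_id z).add_const (circleMap 0 ρ θ • v))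
      simpa using h2.const_mul (c θ)
  refine DifferentiableAt.differentiableWithinAt ?_
  refine (hint.differentiableAt.const_mul (2 * Real.pi * Complex.I : ℂ)⁻¹).congr_of_eventuallyEq ?_
  filter_upwards [ball_mem_nhds z₀ hR] with z hz
  rw [hline z hz, circleIntegral]
  simp [hc, mul_assoc]

/-- Holomorphic functions of several variables are smooth. -/
lemma contDiffOn_of_differentiableOn {n : ℕ} {U : Set (Fin n → ℂ)} (hU : IsOpen U) (m : ℕ)
    {f : (Fin n → ℂ) → ℂ} (hf : DifferentiableOn ℂ f U) : ContDiffOn ℂ m f U := by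
  induction m generalizing f with
  | zero => simpa using hf.continuousOn
  | succ m ih =>
    push_cast
    refine (contDiffOn_succ_iff_fderiv_of_isOpen hU).2 ⟨hf, by simp, ?_⟩
    exact contDiffOn_clm_apply.2 fun v => ih (differentiableOn_fderiv_apply hU hf v)

/-- The identity theorem for holomorphic functions of several variables. -/
lemma eqOn_zero_of_eventuallyEq_zero {n : ℕ} {U : Set (Fin n → ℂ)} (hU : IsOpen U)
    (hUc : IsPreconnected U) {f : (Fin n → ℂ) → ℂ} (hf : DifferentiableOn ℂ f U)
    {z₀ : Fin n → ℂ} (hz₀ : z₀ ∈ U) (h0 : f =ᶠ[𝓝 z₀] 0) : ∀ z ∈ U, f z = 0 := by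
  have hopen : IsOpen {z | f =ᶠ[𝓝 z] 0} := isOpen_setOfPred_eventually_nhds
  have key : U ⊆ {z | f =ᶠ[𝓝 z] 0} := by
    -- The set of points with vanishing germ is open; by connectedness it suffices that it is
    -- relatively closed in `U`.
    refine hUc.subset_of_closure_inter_subset hopen ⟨z₀, hz₀, h0⟩ ?_
    rintro a ⟨hac, haU⟩
    obtain ⟨δ, hδ, hball⟩ := Metric.isOpen_iff.1 hU a haU
    obtain ⟨b, hb, hab⟩ := Metric.mem_closure_iff.1 hac δ hδ
    have hbb : b ∈ ball a δ := by rwa [mem_ball, dist_comm]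
    -- Join `z` to the nearby point `b` of vanishing germ by a complex line. The part of the line
    -- inside the ball is convex, so the one-variable identity theorem applies on it.
    have : ∀ z ∈ ball a δ, f z = 0 := by
      intro z hz
      let γ : ℂ → Fin n → ℂ := fun ζ => b + ζ • (z - b)
      have hγ : Differentiable ℂ γ := by fun_prop
      have hpre : IsPreconnected (γ ⁻¹' ball a δ) := by
        have hconv : Convex ℝ (γ ⁻¹' ball a δ) := by
          intro x hx y hy s t hs ht hst
          have := (convex_ball a δ) hx hy hs ht hst
          have e : γ (s • x + t • y) = s • γ x + t • γ y := by
            simp only [γ, smul_add, add_smul, smul_assoc]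
            have : b = s • b + t • b := by rw [← add_smul, hst, one_smul]
            nth_rw 1 [this]
            abel
          simpa only [mem_preimage, e] using this
        exact hconv.isPreconnected
      have hopen' : IsOpen (γ ⁻¹' ball a δ) := isOpen_ball.preimage hγ.continuous
      have hd : DifferentiableOn ℂ (f ∘ γ) (γ ⁻¹' ball a δ) :=
        (hf.mono hball).comp hγ.differentiableOn (mapsTo_preimage _ _)
      have h1 : (f ∘ γ) =ᶠ[𝓝 0] 0 := by
        have hb' : f =ᶠ[𝓝 (γ 0)] 0 := by simpa [γ] using hb
        exact hγ.continuous.continuousAt.eventually hb'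
      have h2 := (hd.analyticOnNhd hopen').eqOn_zero_of_preconnected_of_eventuallyEq_zero hpre
        (by simpa [γ] using hbb) h1 (show (1 : ℂ) ∈ _ by simpa [γ] using hz)
      simpa [γ] using h2
    exact Filter.eventually_of_mem (ball_mem_nhds a hδ) this
  intro z hz
  exact (key hz).self_of_nhds

end

/-! ### The Levi form and the sub-mean value property -/

section

open Set Filter Topology Metric

/-- The Levi form `∑ φ_{jk̄} ξ_j ξ̄_k` of a real function, through its real second derivative. -/
noncomputable def leviForm {n : ℕ} (φ : (Fin n → ℂ) → ℝ) (z ξ : Fin n → ℂ) : ℝ :=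
  (1 / 4) * (fderiv ℝ (fderiv ℝ φ) z ξ ξ +
    fderiv ℝ (fderiv ℝ φ) z (Complex.I • ξ) (Complex.I • ξ))

section Disc

variable {n : ℕ} {D : Set (Fin n → ℂ)} {φ : (Fin n → ℂ) → ℝ} {a w : Fin n → ℂ}

lemma hasDerivAt_exp_smul (w : Fin n → ℂ) (θ : ℝ) :
    HasDerivAt (fun t : ℝ => Complex.exp (t * Complex.I) • w)
      (Complex.I • Complex.exp (θ * Complex.I) • w) θ := by
  have h1 : HasDerivAt (fun t : ℝ => Complex.exp (t * Complex.I))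
      (Complex.exp (θ * Complex.I) * Complex.I) θ := by
    have h := ((Complex.ofRealCLM.hasDerivAt (x := θ)).mul_const Complex.I).cexp
    simpa using h
  have h2 := h1.smul_const w
  rwa [mul_comm, mul_smul] at h2

lemma contDiffOn_fderiv (hD : IsOpen D) (hφ : ContDiffOn ℝ 2 φ D) :
    ContDiffOn ℝ 1 (fderiv ℝ φ) D :=
  ((contDiffOn_succ_iff_fderiv_of_isOpen (n := 1) hD).1 (by simpa using! hφ)).2.2

/-- The derivative of the circle means of a function with non-negative Levi form is
non-negative. -/
lemma integral_radial_deriv_nonneg (hD : IsOpen D) (hφ : ContDiffOn ℝ 2 φ D)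
    (hL : ∀ z ∈ D, ∀ ξ, 0 ≤ leviForm φ z ξ) (hdisc : ∀ ζ : ℂ, ‖ζ‖ ≤ 1 → a + ζ • w ∈ D)
    {R : ℝ} (hR : 0 < R) (hR1 : R ≤ 1) :
    0 ≤ ∫ θ in (0 : ℝ)..2 * Real.pi,
      fderiv ℝ φ (a + R • Complex.exp (θ * Complex.I) • w) (Complex.exp (θ * Complex.I) • w) := by
  set e : ℝ → Fin n → ℂ := fun t => Complex.exp (t * Complex.I) • w with he
  have hed : ∀ θ, HasDerivAt e (Complex.I • e θ) θ := hasDerivAt_exp_smul w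
  have hec : ContDiff ℝ ⊤ e := by
    have : ContDiff ℝ ⊤ fun t : ℝ => Complex.exp (t * Complex.I) :=
      ((Complex.ofRealCLM.contDiff).mul contDiff_const).cexp
    exact this.smul contDiff_const
  have hmem : ∀ x : ℝ × ℝ, x.1 ∈ Icc (0 : ℝ) 1 → a + x.1 • e x.2 ∈ D := by
    intro x hx
    have := hdisc ((x.1 : ℂ) * Complex.exp (x.2 * Complex.I)) (by
      rw [norm_mul, Complex.norm_exp_ofReal_mul_I, mul_one, Complex.norm_real, Real.norm_eq_abs,
        abs_of_nonneg hx.1]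
      exact hx.2)
    rwa [mul_smul, Complex.coe_smul] at this
  have hΓ : ContDiff ℝ ⊤ fun x : ℝ × ℝ => a + x.1 • e x.2 :=
    contDiff_const.add (contDiff_fst.smul (hec.comp contDiff_snd))
  have hφ' := contDiffOn_fderiv hD hφ
  have hφd : ∀ z ∈ D, HasFDerivAt (fderiv ℝ φ) (fderiv ℝ (fderiv ℝ φ) z) z := fun z hz =>
    ((hφ'.differentiableOn (by norm_num)).differentiableAt (hD.mem_nhds hz)).hasFDerivAt
  have hG : ∀ x : ℝ × ℝ, a + x.1 • e x.2 ∈ D →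
      ContDiffAt ℝ 1 (fun x : ℝ × ℝ => fderiv ℝ φ (a + x.1 • e x.2)) x := fun x hx =>
    ContDiffAt.comp x (hφ'.contDiffAt (hD.mem_nhds hx)) ((hΓ.of_le le_top).contDiffAt)
  have hf : ∀ x : ℝ × ℝ, a + x.1 • e x.2 ∈ D →
      ContDiffAt ℝ 1 (fun x : ℝ × ℝ => x.1 * fderiv ℝ φ (a + x.1 • e x.2) (e x.2)) x := fun x hx =>
    contDiffAt_fst.mul ((hG x hx).clm_apply ((hec.of_le le_top).contDiffAt.comp x contDiffAt_snd))
  have hg : ∀ x : ℝ × ℝ, a + x.1 • e x.2 ∈ D →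
      ContDiffAt ℝ 1
        (fun x : ℝ × ℝ => fderiv ℝ φ (a + x.1 • e x.2) (Complex.I • e x.2)) x := fun x hx =>
    (hG x hx).clm_apply
      (((hec.of_le le_top).contDiffAt.comp x contDiffAt_snd).const_smul Complex.I)
  -- In polar coordinates on the disc, `f = r ∂_r φ` and `g = r⁻¹ ∂_θ φ`, the latter written so that
  -- it makes sense at `r = 0`. The divergence of `(f, g)` is `r` times the Laplacian on the disc,
  -- that is `4r` times the Levi form.
  set f : ℝ × ℝ → ℝ := fun x => x.1 * fderiv ℝ φ (a + x.1 • e x.2) (e x.2) with hfdef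
  set g : ℝ × ℝ → ℝ := fun x => fderiv ℝ φ (a + x.1 • e x.2) (Complex.I • e x.2) with hgdef
  have hf1 : ∀ x : ℝ × ℝ, a + x.1 • e x.2 ∈ D → fderiv ℝ f x (1, 0) =
      fderiv ℝ φ (a + x.1 • e x.2) (e x.2) +
        x.1 * fderiv ℝ (fderiv ℝ φ) (a + x.1 • e x.2) (e x.2) (e x.2) := by
    rintro ⟨r, θ⟩ hx
    have h0 : HasFDerivAt f (fderiv ℝ f (r, θ)) (r, θ) :=
      ((hf _ hx).differentiableAt (by norm_num)).hasFDerivAt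
    have hp : HasDerivAt (fun t : ℝ => (t, θ)) ((1 : ℝ), (0 : ℝ)) r :=
      (hasDerivAt_id' r).prodMk (hasDerivAt_const r θ)
    have h1 : HasDerivAt (fun t : ℝ => f (t, θ)) (fderiv ℝ f (r, θ) (1, 0)) r :=
      HasFDerivAt.comp_hasDerivAt (l := f) (f := fun t : ℝ => (t, θ)) r h0 hp
    have h2 : HasDerivAt (fun t : ℝ => a + t • e θ) (e θ) r := by
      simpa using ((hasDerivAt_id' r).smul_const (e θ)).const_add a
    have h3 : HasDerivAt (fun t : ℝ => fderiv ℝ φ (a + t • e θ))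
        (fderiv ℝ (fderiv ℝ φ) (a + r • e θ) (e θ)) r := (hφd _ hx).comp_hasDerivAt r h2
    have h4 : HasDerivAt (fun t : ℝ => fderiv ℝ φ (a + t • e θ) (e θ))
        (fderiv ℝ (fderiv ℝ φ) (a + r • e θ) (e θ) (e θ)) r := by
      simpa using h3.clm_apply (hasDerivAt_const r (e θ))
    have h5 := (hasDerivAt_id' r).mul h4
    rw [h1.unique h5, one_mul]
  have hg1 : ∀ x : ℝ × ℝ, a + x.1 • e x.2 ∈ D → fderiv ℝ g x (0, 1) =
      x.1 * fderiv ℝ (fderiv ℝ φ) (a + x.1 • e x.2) (Complex.I • e x.2) (Complex.I • e x.2) -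
        fderiv ℝ φ (a + x.1 • e x.2) (e x.2) := by
    rintro ⟨r, θ⟩ hx
    have h0 : HasFDerivAt g (fderiv ℝ g (r, θ)) (r, θ) :=
      ((hg _ hx).differentiableAt (by norm_num)).hasFDerivAt
    have hp : HasDerivAt (fun t : ℝ => (r, t)) ((0 : ℝ), (1 : ℝ)) θ :=
      (hasDerivAt_const θ r).prodMk (hasDerivAt_id' θ)
    have h1 : HasDerivAt (fun t : ℝ => g (r, t)) (fderiv ℝ g (r, θ) (0, 1)) θ :=
      h0.comp_hasDerivAt θ hp
    have h2 : HasDerivAt (fun t : ℝ => a + r • e t) (r • Complex.I • e θ) θ :=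
      ((hed θ).const_smul r).const_add a
    have h3 : HasDerivAt (fun t : ℝ => fderiv ℝ φ (a + r • e t))
        (fderiv ℝ (fderiv ℝ φ) (a + r • e θ) (r • Complex.I • e θ)) θ :=
      (hφd _ hx).comp_hasDerivAt θ h2
    have h4 := h1.unique (h3.clm_apply ((hed θ).const_smul Complex.I))
    rw [h4]
    simp only [map_smul, smul_apply, smul_smul, Complex.I_mul_I, neg_smul,
      one_smul, map_neg, smul_eq_mul]
    ring
  have hsum : ∀ x : ℝ × ℝ, a + x.1 • e x.2 ∈ D → fderiv ℝ f x (1, 0) + fderiv ℝ g x (0, 1) =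
      x.1 * (4 * leviForm φ (a + x.1 • e x.2) (e x.2)) := by
    intro x hx
    rw [hf1 x hx, hg1 x hx, leviForm]
    ring
  have hrect : ∀ x ∈ uIcc (0 : ℝ) R ×ˢ uIcc (0 : ℝ) (2 * Real.pi), a + x.1 • e x.2 ∈ D := by
    rintro x ⟨hx, -⟩
    rw [uIcc_of_le hR.le] at hx
    exact hmem x ⟨hx.1, hx.2.trans hR1⟩
  have hrect' : ∀ x ∈ Ioo (min (0 : ℝ) R) (max 0 R) ×ˢ
      Ioo (min 0 (2 * Real.pi)) (max 0 (2 * Real.pi)), a + x.1 • e x.2 ∈ D := by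
    rintro x ⟨hx, -⟩
    rw [min_eq_left hR.le, max_eq_right hR.le] at hx
    exact hmem x ⟨hx.1.le, hx.2.le.trans hR1⟩
  have hfd : ∀ x ∈ uIcc (0 : ℝ) R ×ˢ uIcc (0 : ℝ) (2 * Real.pi),
      ContinuousAt (fun x => fderiv ℝ f x (1, 0) + fderiv ℝ g x (0, 1)) x := by
    intro x hx
    have h1 := ((hf x (hrect x hx)).fderiv_right (m := 0) (by norm_num)).continuousAt
    have h2 := ((hg x (hrect x hx)).fderiv_right (m := 0) (by norm_num)).continuousAt
    exact (h1.clm_apply continuousAt_const).add (h2.clm_apply continuousAt_const)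
  have hdiv := integral2_divergence_prod_of_hasFDerivAt f g (fderiv ℝ f) (fderiv ℝ g)
    0 0 R (2 * Real.pi)
    (fun x hx => (hf x (hrect x hx)).continuousAt.continuousWithinAt)
    (fun x hx => (hg x (hrect x hx)).continuousAt.continuousWithinAt)
    (fun x hx => ((hf x (hrect' x hx)).differentiableAt (by norm_num)).hasFDerivAt)
    (fun x hx => ((hg x (hrect' x hx)).differentiableAt (by norm_num)).hasFDerivAt)
    (ContinuousOn.integrableOn_compact (isCompact_uIcc.prod isCompact_uIcc)
      fun x hx => (hfd x hx).continuousWithinAt)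
  -- Of the four boundary terms, the two in `θ` cancel by periodicity and the one at `r = 0`
  -- vanishes; only the integral over the circle of radius `R` remains.
  have hper : ∀ r, g (r, 2 * Real.pi) = g (r, 0) := by
    intro r
    have : e (2 * Real.pi) = e 0 := by simp [he]
    simp only [hgdef, this]
  have h0 : ∀ t, f (0, t) = 0 := fun t => by simp [hfdef]
  simp only [hper, h0, sub_self, zero_add, intervalIntegral.integral_zero, sub_zero] at hdiv
  have hnn : 0 ≤ ∫ θ in (0 : ℝ)..2 * Real.pi, f (R, θ) := by
    rw [← hdiv]
    refine intervalIntegral.integral_nonneg hR.le fun r hr =>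
      intervalIntegral.integral_nonneg (by positivity) fun θ _ => ?_
    have hx := hmem (r, θ) ⟨hr.1, hr.2.trans hR1⟩
    rw [hsum _ hx]
    exact mul_nonneg hr.1 (mul_nonneg (by norm_num) (hL _ hx _))
  simp only [hfdef, intervalIntegral.integral_const_mul] at hnn
  exact nonneg_of_mul_nonneg_right hnn hR

/-- A `C²` function with non-negative Levi form is plurisubharmonic. -/
lemma isPSH_of_leviForm_nonneg (hD : IsOpen D) (hφ : ContDiffOn ℝ 2 φ D)
    (hL : ∀ z ∈ D, ∀ ξ, 0 ≤ leviForm φ z ξ) : IsPSH D φ := by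
  refine ⟨hφ.continuousOn.upperSemicontinuousOn, fun a w hdisc => ?_⟩
  have hφ' := contDiffOn_fderiv hD hφ
  have hcirc : CircleIntegrable (fun ζ : ℂ => φ (a + ζ • w)) 0 1 := by
    refine ContinuousOn.circleIntegrable zero_le_one ?_
    refine hφ.continuousOn.comp (by fun_prop) fun ζ hζ => hdisc ζ ?_
    simpa using (mem_sphere.1 hζ).le
  refine ⟨hcirc, ?_⟩
  set e : ℝ → Fin n → ℂ := fun t => Complex.exp (t * Complex.I) • w with he
  have hec : Continuous e := by fun_prop
  have hmem : ∀ x : ℝ × ℝ, x.1 ∈ Icc (0 : ℝ) 1 → a + x.1 • e x.2 ∈ D := by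
    intro x hx
    have := hdisc ((x.1 : ℂ) * Complex.exp (x.2 * Complex.I)) (by
      rw [norm_mul, Complex.norm_exp_ofReal_mul_I, mul_one, Complex.norm_real, Real.norm_eq_abs,
        abs_of_nonneg hx.1]
      exact hx.2)
    rwa [mul_smul, Complex.coe_smul] at this
  have hH : ContinuousOn (fun x : ℝ × ℝ => fderiv ℝ φ (a + x.1 • e x.2) (e x.2))
      {x | x.1 ∈ Icc (0 : ℝ) 1} := by
    refine ContinuousOn.clm_apply ?_ (by fun_prop)
    exact hφ'.continuousOn.comp (by fun_prop) fun x hx => hmem x hx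
  have hray : ∀ θ, φ (a + e θ) - φ a = ∫ r in (0 : ℝ)..1, fderiv ℝ φ (a + r • e θ) (e θ) := by
    intro θ
    have h1 : ∀ r ∈ uIcc (0 : ℝ) 1,
        HasDerivAt (fun r : ℝ => φ (a + r • e θ)) (fderiv ℝ φ (a + r • e θ) (e θ)) r := by
      intro r hr
      rw [uIcc_of_le zero_le_one] at hr
      have hx := hmem (r, θ) hr
      have h2 : HasDerivAt (fun t : ℝ => a + t • e θ) (e θ) r := by
        simpa using ((hasDerivAt_id r).smul_const (e θ)).const_add a
      exact ((hφ.differentiableOn (by norm_num)).differentiableAt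
        (hD.mem_nhds hx)).hasFDerivAt.comp_hasDerivAt r h2
    rw [intervalIntegral.integral_eq_sub_of_hasDerivAt h1]
    · simp
    · refine ContinuousOn.intervalIntegrable ?_
      rw [uIcc_of_le zero_le_one]
      exact hH.comp (f := fun r : ℝ => (r, θ)) (by fun_prop) fun r hr => hr
  have hnn : 0 ≤ ∫ θ in (0 : ℝ)..2 * Real.pi, (φ (a + e θ) - φ a) := by
    simp only [hray]
    rw [intervalIntegral_intervalIntegral_swap]
    · refine intervalIntegral.integral_nonneg_of_ae_restrict zero_le_one ?_
      rw [Filter.EventuallyLE, ae_restrict_iff' measurableSet_Icc]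
      -- The radial estimate divides by the radius, so the null set `r = 0` is discarded.
      have : ∀ᵐ r : ℝ, r ≠ 0 := by simp [ae_iff]
      filter_upwards [this] with r hr0 hr
      exact integral_radial_deriv_nonneg hD hφ hL hdisc (lt_of_le_of_ne hr.1 hr0.symm) hr.2
    · refine (ContinuousOn.integrableOn_compact (isCompact_uIcc.prod isCompact_uIcc)
        (hH.comp (f := fun x : ℝ × ℝ => (x.2, x.1)) (by fun_prop) ?_)).mono_set
        (prod_mono uIoc_subset_uIcc uIoc_subset_uIcc)
      rintro x ⟨-, hx⟩
      simpa [uIcc_of_le] using hx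
  have hci : IntervalIntegrable (fun θ => φ (a + e θ)) volume 0 (2 * Real.pi) := by
    have := hcirc
    simpa [CircleIntegrable, circleMap, he] using this
  rw [intervalIntegral.integral_sub hci (by simp)] at hnn
  rw [Real.circleAverage_def]
  simp only [circleMap, zero_add, Complex.ofReal_one, one_mul]
  have hpi : 0 < 2 * Real.pi := by positivity
  rw [intervalIntegral.integral_const, sub_zero, smul_eq_mul] at hnn
  rw [smul_eq_mul, inv_mul_eq_div, le_div_iff₀ hpi]
  linarith

end Disc

end

/-! ### Directional Wirtinger calculus and integration by parts -/

section

open Set Filter Topology Metric ComplexConjugate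

variable {n : ℕ}

/-- The Wirtinger derivative `∑ ξ_j ∂u/∂z_j`. -/
noncomputable def dDir (ξ : Fin n → ℂ) (u : (Fin n → ℂ) → ℂ) (z : Fin n → ℂ) : ℂ :=
  (1 / 2 : ℂ) * (fderiv ℝ u z ξ - Complex.I * fderiv ℝ u z (Complex.I • ξ))

/-- The Wirtinger derivative `∑ ξ̄_j ∂u/∂z̄_j`. -/
noncomputable def dbarDir (ξ : Fin n → ℂ) (u : (Fin n → ℂ) → ℂ) (z : Fin n → ℂ) : ℂ :=
  (1 / 2 : ℂ) * (fderiv ℝ u z ξ + Complex.I * fderiv ℝ u z (Complex.I • ξ))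

section Calculus

variable {ξ z : Fin n → ℂ} {u v : (Fin n → ℂ) → ℂ}

lemma dDir_mul (hu : DifferentiableAt ℝ u z) (hv : DifferentiableAt ℝ v z) :
    dDir ξ (fun y => u y * v y) z = dDir ξ u z * v z + u z * dDir ξ v z := by
  simp only [dDir, fderiv_fun_mul hu hv, add_apply, smul_apply, smul_eq_mul]
  ring

lemma dbarDir_mul (hu : DifferentiableAt ℝ u z) (hv : DifferentiableAt ℝ v z) :
    dbarDir ξ (fun y => u y * v y) z = dbarDir ξ u z * v z + u z * dbarDir ξ v z := by
  simp only [dbarDir, fderiv_fun_mul hu hv, add_apply, smul_apply, smul_eq_mul]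
  ring

lemma dbarDir_sub (hu : DifferentiableAt ℝ u z) (hv : DifferentiableAt ℝ v z) :
    dbarDir ξ (fun y => u y - v y) z = dbarDir ξ u z - dbarDir ξ v z := by
  simp only [dbarDir, fderiv_fun_sub hu hv, sub_apply]
  ring

lemma fderiv_conj_comp (u : (Fin n → ℂ) → ℂ) (z ξ : Fin n → ℂ) :
    fderiv ℝ (fun y => conj (u y)) z ξ = conj (fderiv ℝ u z ξ) := by
  have : (fun y => conj (u y)) = Complex.conjCLE ∘ u := by
    funext y; simp
  rw [this, Complex.conjCLE.comp_fderiv]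
  simp

lemma dbarDir_conj (ξ : Fin n → ℂ) (u : (Fin n → ℂ) → ℂ) (z : Fin n → ℂ) :
    dbarDir ξ (fun y => conj (u y)) z = conj (dDir ξ u z) := by
  simp only [dbarDir, dDir, fderiv_conj_comp, map_mul, map_sub, map_div₀, map_one, Complex.conj_I,
    map_ofNat]
  ring

lemma dDir_conj (ξ : Fin n → ℂ) (u : (Fin n → ℂ) → ℂ) (z : Fin n → ℂ) :
    dDir ξ (fun y => conj (u y)) z = conj (dbarDir ξ u z) := by
  simp only [dbarDir, dDir, fderiv_conj_comp, map_mul, map_add, map_div₀, map_one, Complex.conj_I,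
    map_ofNat]
  ring

lemma fderiv_real_eq (hu : DifferentiableAt ℂ u z) (ξ : Fin n → ℂ) :
    fderiv ℝ u z ξ = fderiv ℂ u z ξ := by
  rw [(hu.hasFDerivAt.restrictScalars ℝ).fderiv]
  rfl

lemma dbarDir_of_differentiableAt (hu : DifferentiableAt ℂ u z) : dbarDir ξ u z = 0 := by
  rw [dbarDir, fderiv_real_eq hu, fderiv_real_eq hu, map_smul, smul_eq_mul, ← mul_assoc,
    Complex.I_mul_I]
  ring

lemma dDir_of_differentiableAt (hu : DifferentiableAt ℂ u z) :
    dDir ξ u z = fderiv ℂ u z ξ := by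
  rw [dDir, fderiv_real_eq hu, fderiv_real_eq hu, map_smul, smul_eq_mul, ← mul_assoc,
    Complex.I_mul_I]
  ring

lemma fderiv_ofReal_comp {φ : (Fin n → ℂ) → ℝ} (hφ : DifferentiableAt ℝ φ z) (ξ : Fin n → ℂ) :
    fderiv ℝ (fun y => (φ y : ℂ)) z ξ = (fderiv ℝ φ z ξ : ℂ) := by
  have := (Complex.ofRealCLM.hasFDerivAt (x := φ z)).comp z hφ.hasFDerivAt
  have h2 : HasFDerivAt (fun y => (φ y : ℂ)) (Complex.ofRealCLM.comp (fderiv ℝ φ z)) z := this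
  rw [h2.fderiv]
  simp

lemma fderiv_exp_neg {φ : (Fin n → ℂ) → ℝ} (hφ : DifferentiableAt ℝ φ z) (ξ : Fin n → ℂ) :
    fderiv ℝ (fun y => (Real.exp (-φ y) : ℂ)) z ξ =
      -(Real.exp (-φ z) : ℂ) * fderiv ℝ (fun y => (φ y : ℂ)) z ξ := by
  have h : HasFDerivAt (fun y => Real.exp (-φ y)) (Real.exp (-φ z) • -fderiv ℝ φ z) z :=
    hφ.hasFDerivAt.neg.exp
  rw [fderiv_ofReal_comp h.differentiableAt, fderiv_ofReal_comp hφ, h.fderiv]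
  simp

lemma dDir_exp_neg {φ : (Fin n → ℂ) → ℝ} (hφ : DifferentiableAt ℝ φ z) :
    dDir ξ (fun y => (Real.exp (-φ y) : ℂ)) z =
      -(Real.exp (-φ z) : ℂ) * dDir ξ (fun y => (φ y : ℂ)) z := by
  simp only [dDir, fderiv_exp_neg hφ]
  ring

lemma dbarDir_exp_neg {φ : (Fin n → ℂ) → ℝ} (hφ : DifferentiableAt ℝ φ z) :
    dbarDir ξ (fun y => (Real.exp (-φ y) : ℂ)) z =
      -(Real.exp (-φ z) : ℂ) * dbarDir ξ (fun y => (φ y : ℂ)) z := by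
  simp only [dbarDir, fderiv_exp_neg hφ]
  ring

lemma differentiableAt_fderiv {F : Type*} [NormedAddCommGroup F] [NormedSpace ℝ F]
    {u : (Fin n → ℂ) → F} (hu : ContDiffAt ℝ 2 u z) : DifferentiableAt ℝ (fderiv ℝ u) z :=
  (hu.fderiv_right (m := 1) (by norm_num)).differentiableAt (by norm_num)

lemma fderiv_fderiv_apply {F : Type*} [NormedAddCommGroup F] [NormedSpace ℝ F]
    {u : (Fin n → ℂ) → F} (hu : ContDiffAt ℝ 2 u z) (ξ η : Fin n → ℂ) :
    fderiv ℝ (fun y => fderiv ℝ u y ξ) z η = fderiv ℝ (fderiv ℝ u) z η ξ := by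
  rw [fderiv_clm_apply (differentiableAt_fderiv hu) (differentiableAt_const ξ)]
  simp

lemma differentiableAt_fderiv_apply {u : (Fin n → ℂ) → ℂ} (hu : ContDiffAt ℝ 2 u z)
    (ξ : Fin n → ℂ) : DifferentiableAt ℝ (fun y => fderiv ℝ u y ξ) z :=
  (differentiableAt_fderiv hu).clm_apply (differentiableAt_const ξ)

lemma fderiv_dDir (hu : ContDiffAt ℝ 2 u z) (ξ η : Fin n → ℂ) :
    fderiv ℝ (dDir ξ u) z η = (1 / 2 : ℂ) * (fderiv ℝ (fderiv ℝ u) z η ξ -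
      Complex.I * fderiv ℝ (fderiv ℝ u) z η (Complex.I • ξ)) := by
  have h1 := (differentiableAt_fderiv_apply hu ξ).hasFDerivAt
  have h2 := (differentiableAt_fderiv_apply hu (Complex.I • ξ)).hasFDerivAt
  have h3 : HasFDerivAt (dDir ξ u) _ z := (h1.fun_sub (h2.const_mul Complex.I)).const_mul (1 / 2 : ℂ)
  rw [h3.fderiv]
  simp only [smul_apply, sub_apply, fderiv_fderiv_apply hu, smul_eq_mul]

lemma fderiv_dbarDir (hu : ContDiffAt ℝ 2 u z) (ξ η : Fin n → ℂ) :
    fderiv ℝ (dbarDir ξ u) z η = (1 / 2 : ℂ) * (fderiv ℝ (fderiv ℝ u) z η ξ +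
      Complex.I * fderiv ℝ (fderiv ℝ u) z η (Complex.I • ξ)) := by
  have h1 := (differentiableAt_fderiv_apply hu ξ).hasFDerivAt
  have h2 := (differentiableAt_fderiv_apply hu (Complex.I • ξ)).hasFDerivAt
  have h3 : HasFDerivAt (dbarDir ξ u) _ z :=
    (h1.fun_add (h2.const_mul Complex.I)).const_mul (1 / 2 : ℂ)
  rw [h3.fderiv]
  simp only [smul_apply, add_apply, fderiv_fderiv_apply hu, smul_eq_mul]

lemma fderiv_fderiv_comm {F : Type*} [NormedAddCommGroup F] [NormedSpace ℝ F]
    {u : (Fin n → ℂ) → F} (hu : ContDiffAt ℝ 2 u z) (ξ η : Fin n → ℂ) :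
    fderiv ℝ (fderiv ℝ u) z ξ η = fderiv ℝ (fderiv ℝ u) z η ξ :=
  (hu.isSymmSndFDerivAt (by simp)).eq ξ η

/-- The mixed terms in `ξ` and `iξ` cancel by symmetry of the second derivative. -/
lemma dbarDir_dDir (hu : ContDiffAt ℝ 2 u z) (ξ : Fin n → ℂ) :
    dbarDir ξ (dDir ξ u) z = (1 / 4 : ℂ) * (fderiv ℝ (fderiv ℝ u) z ξ ξ +
      fderiv ℝ (fderiv ℝ u) z (Complex.I • ξ) (Complex.I • ξ)) := by
  rw [dbarDir, fderiv_dDir hu, fderiv_dDir hu, fderiv_fderiv_comm hu ξ (Complex.I • ξ)]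
  linear_combination (-1 / 4 * fderiv ℝ (fderiv ℝ u) z (Complex.I • ξ) (Complex.I • ξ)) *
    Complex.I_mul_I

lemma dDir_dbarDir (hu : ContDiffAt ℝ 2 u z) (ξ : Fin n → ℂ) :
    dDir ξ (dbarDir ξ u) z = dbarDir ξ (dDir ξ u) z := by
  rw [dbarDir_dDir hu, dDir, fderiv_dbarDir hu, fderiv_dbarDir hu,
    fderiv_fderiv_comm hu ξ (Complex.I • ξ)]
  linear_combination (-1 / 4 * fderiv ℝ (fderiv ℝ u) z (Complex.I • ξ) (Complex.I • ξ)) *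
    Complex.I_mul_I

lemma contDiffAt_ofReal_comp {φ : (Fin n → ℂ) → ℝ} {m : WithTop ℕ∞} (hφ : ContDiffAt ℝ m φ z) :
    ContDiffAt ℝ m (fun y => (φ y : ℂ)) z :=
  Complex.ofRealCLM.contDiff.contDiffAt.comp z hφ

lemma fderiv_fderiv_ofReal {φ : (Fin n → ℂ) → ℝ} (hφ : ContDiffAt ℝ 2 φ z) (ξ η : Fin n → ℂ) :
    fderiv ℝ (fderiv ℝ fun y => (φ y : ℂ)) z ξ η = (fderiv ℝ (fderiv ℝ φ) z ξ η : ℂ) := by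
  rw [← fderiv_fderiv_apply (contDiffAt_ofReal_comp hφ), ← fderiv_fderiv_apply hφ,
    ← fderiv_ofReal_comp]
  · refine congrArg (fun L : (Fin n → ℂ) →L[ℝ] ℂ => L ξ) (Filter.EventuallyEq.fderiv_eq ?_)
    filter_upwards [hφ.eventually (by simp)] with y hy
    exact fderiv_ofReal_comp (hy.differentiableAt (by norm_num)) η
  · exact (differentiableAt_fderiv hφ).clm_apply (differentiableAt_const η)

lemma dbarDir_dDir_ofReal {φ : (Fin n → ℂ) → ℝ} (hφ : ContDiffAt ℝ 2 φ z) (ξ : Fin n → ℂ) :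
    dbarDir ξ (dDir ξ fun y => (φ y : ℂ)) z = (leviForm φ z ξ : ℂ) := by
  rw [dbarDir_dDir (contDiffAt_ofReal_comp hφ), fderiv_fderiv_ofReal hφ, fderiv_fderiv_ofReal hφ,
    leviForm]
  push_cast
  ring

lemma contDiffAt_dDir (hu : ContDiffAt ℝ 2 u z) (ξ : Fin n → ℂ) :
    ContDiffAt ℝ 1 (dDir ξ u) z := by
  have h := hu.fderiv_right (m := 1) (by norm_num)
  exact contDiffAt_const.mul ((h.clm_apply contDiffAt_const).sub
    (contDiffAt_const.mul (h.clm_apply contDiffAt_const)))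

lemma contDiffAt_dbarDir (hu : ContDiffAt ℝ 2 u z) (ξ : Fin n → ℂ) :
    ContDiffAt ℝ 1 (dbarDir ξ u) z := by
  have h := hu.fderiv_right (m := 1) (by norm_num)
  exact contDiffAt_const.mul ((h.clm_apply contDiffAt_const).add
    (contDiffAt_const.mul (h.clm_apply contDiffAt_const)))

lemma continuousAt_dbarDir (hu : ContDiffAt ℝ 1 u z) (ξ : Fin n → ℂ) :
    ContinuousAt (dbarDir ξ u) z := by
  have h := (hu.fderiv_right (m := 0) (by norm_num)).continuousAt
  exact continuousAt_const.mul ((h.clm_apply continuousAt_const).add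
    (continuousAt_const.mul (h.clm_apply continuousAt_const)))

end Calculus

section Integration

variable {D : Set (Fin n → ℂ)} {u v θ : (Fin n → ℂ) → ℂ}

lemma integrable_mul_of_tsupport_subset (hD : IsOpen D) (hu : ContinuousOn u D)
    (hθ : ContinuousOn θ D) (hc : HasCompactSupport θ) (hs : tsupport θ ⊆ D) :
    Integrable fun z => u z * θ z := by
  have h1 : tsupport (fun z => u z * θ z) ⊆ tsupport θ := tsupport_mul_subset_right
  refine Continuous.integrable_of_hasCompactSupport ?_ (hc.mul_left)
  exact (hu.mul hθ).continuous_of_tsupport_subset hD (h1.trans hs)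

lemma integral_mul_fderiv_of_tsupport_subset (hD : IsOpen D) (hu : ContDiffOn ℝ 1 u D)
    (hθ : ContDiff ℝ 1 θ) (hc : HasCompactSupport θ) (hs : tsupport θ ⊆ D) (ξ : Fin n → ℂ) :
    Integrable (fun z => u z * fderiv ℝ θ z ξ) ∧ Integrable (fun z => fderiv ℝ u z ξ * θ z) ∧
      ∫ z, u z * fderiv ℝ θ z ξ = -∫ z, fderiv ℝ u z ξ * θ z := by
  have hu' : ContinuousOn (fun z => fderiv ℝ u z ξ) D :=
    (hu.continuousOn_fderiv_of_isOpen hD le_rfl).clm_apply continuousOn_const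
  have hθ' : Continuous fun z => fderiv ℝ θ z ξ :=
    (hθ.continuous_fderiv one_ne_zero).clm_apply continuous_const
  have hs' : tsupport (fun z => fderiv ℝ θ z ξ) ⊆ tsupport θ := tsupport_fderiv_apply_subset ℝ ξ
  have i1 := integrable_mul_of_tsupport_subset hD hu.continuousOn hθ'.continuousOn
    (hc.fderiv_apply ℝ ξ) (hs'.trans hs)
  have i2 := integrable_mul_of_tsupport_subset hD hu' hθ.continuous.continuousOn hc hs
  have i3 := integrable_mul_of_tsupport_subset hD hu.continuousOn hθ.continuous.continuousOn hc hs
  refine ⟨i1, i2, integral_mul_fderiv_eq_neg_fderiv_mul_of_integrable i2 i1 i3 ?_ ?_⟩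
  · exact fun x hx => (hu.differentiableOn one_ne_zero).differentiableAt (hD.mem_nhds (hs hx))
  · exact fun x _ => hθ.differentiable one_ne_zero x

lemma integral_mul_dbarDir (hD : IsOpen D) (hu : ContDiffOn ℝ 1 u D)
    (hθ : ContDiff ℝ 1 θ) (hc : HasCompactSupport θ) (hs : tsupport θ ⊆ D) (ξ : Fin n → ℂ) :
    ∫ z, u z * dbarDir ξ θ z = -∫ z, dbarDir ξ u z * θ z := by
  obtain ⟨a1, a2, a3⟩ := integral_mul_fderiv_of_tsupport_subset hD hu hθ hc hs ξ
  obtain ⟨b1, b2, b3⟩ := integral_mul_fderiv_of_tsupport_subset hD hu hθ hc hs (Complex.I • ξ)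
  have e1 : ∀ z, u z * dbarDir ξ θ z = (1 / 2 : ℂ) * (u z * fderiv ℝ θ z ξ +
      Complex.I * (u z * fderiv ℝ θ z (Complex.I • ξ))) := fun z => by rw [dbarDir]; ring
  have e2 : ∀ z, dbarDir ξ u z * θ z = (1 / 2 : ℂ) * (fderiv ℝ u z ξ * θ z +
      Complex.I * (fderiv ℝ u z (Complex.I • ξ) * θ z)) := fun z => by rw [dbarDir]; ring
  simp only [e1, e2, integral_const_mul]
  rw [integral_add a1 (b1.const_mul _), integral_add a2 (b2.const_mul _), integral_const_mul,
    integral_const_mul, a3, b3]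
  ring

lemma integral_mul_dDir (hD : IsOpen D) (hu : ContDiffOn ℝ 1 u D)
    (hθ : ContDiff ℝ 1 θ) (hc : HasCompactSupport θ) (hs : tsupport θ ⊆ D) (ξ : Fin n → ℂ) :
    ∫ z, u z * dDir ξ θ z = -∫ z, dDir ξ u z * θ z := by
  obtain ⟨a1, a2, a3⟩ := integral_mul_fderiv_of_tsupport_subset hD hu hθ hc hs ξ
  obtain ⟨b1, b2, b3⟩ := integral_mul_fderiv_of_tsupport_subset hD hu hθ hc hs (Complex.I • ξ)
  have e1 : ∀ z, u z * dDir ξ θ z = (1 / 2 : ℂ) * (u z * fderiv ℝ θ z ξ -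
      Complex.I * (u z * fderiv ℝ θ z (Complex.I • ξ))) := fun z => by rw [dDir]; ring
  have e2 : ∀ z, dDir ξ u z * θ z = (1 / 2 : ℂ) * (fderiv ℝ u z ξ * θ z -
      Complex.I * (fderiv ℝ u z (Complex.I • ξ) * θ z)) := fun z => by rw [dDir]; ring
  simp only [e1, e2, integral_const_mul]
  rw [integral_sub a1 (b1.const_mul _), integral_sub a2 (b2.const_mul _), integral_const_mul,
    integral_const_mul, a3, b3]
  ring

end Integration

end

/-! ### The Chern connection and the Bochner–Kodaira identity -/

section

open Set Filter Topology Metric ComplexConjugate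

variable {n : ℕ}

/-- The `(1,0)`-part of the Chern connection of the weight `e^{-Φ}` in the direction `ξ`. -/
noncomputable def chernDir (ξ : Fin n → ℂ) (Φ : (Fin n → ℂ) → ℝ) (η : (Fin n → ℂ) → ℂ)
    (z : Fin n → ℂ) : ℂ :=
  dDir ξ η z - η z * dDir ξ (fun y => (Φ y : ℂ)) z

section BochnerKodaira

variable {D : Set (Fin n → ℂ)} {Φ : (Fin n → ℂ) → ℝ} {η : (Fin n → ℂ) → ℂ}

lemma contDiffAt_exp_neg {m : WithTop ℕ∞} {z : Fin n → ℂ} (hΦ : ContDiffAt ℝ m Φ z) :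
    ContDiffAt ℝ m (fun z => (Real.exp (-Φ z) : ℂ)) z :=
  contDiffAt_ofReal_comp hΦ.neg.exp

lemma contDiff_conj_comp {m : WithTop ℕ∞} (hη : ContDiff ℝ m η) :
    ContDiff ℝ m fun z => conj (η z) :=
  Complex.conjCLE.contDiff.comp hη

lemma tsupport_conj_mul_subset (η v : (Fin n → ℂ) → ℂ) :
    tsupport (fun z => conj (η z) * v z) ⊆ tsupport η := by
  refine closure_mono fun z hz h => hz ?_
  simp [h]

/-- Nothing is known about `φ` and `f` outside `D`; products with a function supported in `D` are
nevertheless globally smooth, because only points of the support matter. -/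
lemma contDiff_of_contDiffAt_tsupport {m : WithTop ℕ∞}
    (h : ∀ z ∈ tsupport η, ContDiffAt ℝ m η z) : ContDiff ℝ m η := by
  refine contDiff_iff_contDiffAt.2 fun z => ?_
  by_cases hz : z ∈ tsupport η
  · exact h z hz
  · exact contDiffAt_const.congr_of_eventuallyEq (notMem_tsupport_iff_eventuallyEq.1 hz)

lemma contDiff_conj_mul_exp (hD : IsOpen D) (hΦ : ContDiffOn ℝ 2 Φ D) (hη : ContDiff ℝ 2 η)
    (hs : tsupport η ⊆ D) : ContDiff ℝ 2 fun z => conj (η z) * (Real.exp (-Φ z) : ℂ) := by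
  refine contDiff_of_contDiffAt_tsupport fun z hz => ?_
  have hzD := hs (tsupport_conj_mul_subset η _ hz)
  exact (contDiff_conj_comp hη).contDiffAt.mul
    (contDiffAt_exp_neg (hΦ.contDiffAt (hD.mem_nhds hzD)))

lemma eq_zero_of_notMem_tsupport {z : Fin n → ℂ} (hz : z ∉ tsupport η) (ξ : Fin n → ℂ) :
    η z = 0 ∧ dDir ξ η z = 0 ∧ dbarDir ξ η z = 0 := by
  have h0 : η =ᶠ[𝓝 z] fun _ => 0 := notMem_tsupport_iff_eventuallyEq.1 hz
  have h1 : fderiv ℝ η z = 0 := by rw [h0.fderiv_eq]; simp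
  exact ⟨image_eq_zero_of_notMem_tsupport hz, by simp [dDir, h1], by simp [dbarDir, h1]⟩

/-- This makes `-chernDir` the adjoint of `dbarDir` in the weighted space: differentiating `e^{-Φ}`
produces the connection term, and `∂̄_ξ Φ` is the conjugate of `∂_ξ Φ` because `Φ` is real. -/
lemma dbarDir_conj_mul_exp (hD : IsOpen D) (hΦ : ContDiffOn ℝ 2 Φ D) (hη : ContDiff ℝ 2 η)
    (hs : tsupport η ⊆ D) (ξ z : Fin n → ℂ) :
    dbarDir ξ (fun z => conj (η z) * (Real.exp (-Φ z) : ℂ)) z =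
      conj (chernDir ξ Φ η z) * (Real.exp (-Φ z) : ℂ) := by
  by_cases hz : z ∈ tsupport η
  · have hΦz := (hΦ.contDiffAt (hD.mem_nhds (hs hz)))
    have hΦd := hΦz.differentiableAt (by norm_num)
    have hr : (fun y => conj (Φ y : ℂ)) = fun y => (Φ y : ℂ) := by
      funext y; simp
    have hc := dbarDir_conj ξ (fun y => (Φ y : ℂ)) z
    rw [hr] at hc
    rw [dbarDir_mul ((contDiff_conj_comp hη).differentiable (by norm_num) z)
      ((contDiffAt_exp_neg hΦz).differentiableAt (by norm_num)), dbarDir_conj,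
      dbarDir_exp_neg hΦd, chernDir, map_sub, map_mul, ← hc]
    ring
  · obtain ⟨h1, h2, -⟩ := eq_zero_of_notMem_tsupport hz ξ
    have hz' : z ∉ tsupport (fun z => conj (η z) * (Real.exp (-Φ z) : ℂ)) := fun h =>
      hz (tsupport_conj_mul_subset η _ h)
    rw [(eq_zero_of_notMem_tsupport hz' ξ).2.2, chernDir, h1, h2]
    simp

lemma chernDir_eq_zero {z : Fin n → ℂ} (hz : z ∉ tsupport η) (ξ : Fin n → ℂ) :
    chernDir ξ Φ η z = 0 := by
  obtain ⟨h1, h2, -⟩ := eq_zero_of_notMem_tsupport hz ξ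
  simp [chernDir, h1, h2]

lemma contDiffAt_chernDir {z : Fin n → ℂ} (hΦ : ContDiffAt ℝ 2 Φ z) (hη : ContDiff ℝ 2 η)
    (ξ : Fin n → ℂ) : ContDiffAt ℝ 1 (chernDir ξ Φ η) z :=
  (contDiffAt_dDir hη.contDiffAt ξ).sub
    ((hη.contDiffAt.of_le (by norm_num)).mul (contDiffAt_dDir (contDiffAt_ofReal_comp hΦ) ξ))

/-- The commutator of `∂̄_ξ` with the connection is the curvature of the weight; this is the source
of the Levi form in the Bochner–Kodaira identity. -/
lemma dbarDir_chernDir {z : Fin n → ℂ} (hΦ : ContDiffAt ℝ 2 Φ z) (hη : ContDiff ℝ 2 η)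
    (ξ : Fin n → ℂ) : dbarDir ξ (chernDir ξ Φ η) z =
      chernDir ξ Φ (dbarDir ξ η) z - η z * leviForm Φ z ξ := by
  have h1 := (contDiffAt_dDir hη.contDiffAt (z := z) ξ).differentiableAt (by norm_num)
  have h2 := (contDiffAt_dDir (contDiffAt_ofReal_comp hΦ) ξ).differentiableAt (by norm_num)
  have h3 := hη.differentiable (by norm_num) z
  have : chernDir ξ Φ η =
      fun y => dDir ξ η y - η y * dDir ξ (fun y => (Φ y : ℂ)) y := rfl
  rw [this, dbarDir_sub h1 (h3.fun_mul h2), dbarDir_mul h3 h2, dbarDir_dDir_ofReal hΦ, chernDir,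
    dDir_dbarDir hη.contDiffAt]
  ring

/-- Integration by parts against a compactly supported function. -/
lemma integral_mul_conj_chernDir (hD : IsOpen D) (hΦ : ContDiffOn ℝ 2 Φ D) (hη : ContDiff ℝ 2 η)
    (hc : HasCompactSupport η) (hs : tsupport η ⊆ D) {u : (Fin n → ℂ) → ℂ}
    (hu : ContDiffOn ℝ 1 u D) (ξ : Fin n → ℂ) :
    ∫ z, u z * (conj (chernDir ξ Φ η z) * (Real.exp (-Φ z) : ℂ)) =
      -∫ z, dbarDir ξ u z * (conj (η z) * (Real.exp (-Φ z) : ℂ)) := by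
  have hss := tsupport_conj_mul_subset η fun z => (Real.exp (-Φ z) : ℂ)
  rw [← integral_mul_dbarDir hD hu
    ((contDiff_conj_mul_exp hD hΦ hη hs).of_le (by norm_num))
    (hc.of_isClosed_subset (isClosed_tsupport _) hss) (hss.trans hs) ξ]
  simp only [dbarDir_conj_mul_exp hD hΦ hη hs]

/-- The Bochner–Kodaira identity in the direction `ξ`. -/
lemma bochnerKodaira_complex (hD : IsOpen D) (hΦ : ContDiffOn ℝ 2 Φ D) (hη : ContDiff ℝ 2 η)
    (hc : HasCompactSupport η) (hs : tsupport η ⊆ D) (ξ : Fin n → ℂ) :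
    ∫ z, chernDir ξ Φ η z * (conj (chernDir ξ Φ η z) * (Real.exp (-Φ z) : ℂ)) =
      (∫ z, (leviForm Φ z ξ : ℂ) * (η z * (conj (η z) * (Real.exp (-Φ z) : ℂ)))) +
        ∫ z, dbarDir ξ η z * (conj (dbarDir ξ η z) * (Real.exp (-Φ z) : ℂ)) := by
  have hΦa : ∀ z ∈ D, ContDiffAt ℝ 2 Φ z := fun z hz => hΦ.contDiffAt (hD.mem_nhds hz)
  have hη1 : ContDiff ℝ 1 (dbarDir ξ η) :=
    contDiff_iff_contDiffAt.2 fun z => contDiffAt_dbarDir hη.contDiffAt ξ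
  have hconj1 : ContDiff ℝ 1 fun z => conj (η z) := (contDiff_conj_comp hη).of_le (by norm_num)
  have hconj_s : tsupport (fun z => conj (η z)) ⊆ tsupport η := by
    simpa using tsupport_conj_mul_subset η fun _ => 1
  have hconj_c : HasCompactSupport fun z => conj (η z) :=
    hc.of_isClosed_subset (isClosed_tsupport _) hconj_s
  have hw : ContDiffOn ℝ 1 (fun z => dbarDir ξ η z * (Real.exp (-Φ z) : ℂ)) D := fun z hz =>
    (hη1.contDiffAt.mul ((contDiffAt_exp_neg (hΦa z hz)).of_le (by norm_num))).contDiffWithinAt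
  have hA := integral_mul_conj_chernDir hD hΦ hη hc hs (u := chernDir ξ Φ η)
    (fun z hz => (contDiffAt_chernDir (hΦa z hz) hη ξ).contDiffWithinAt) ξ
  -- `hA` moves the connection off one factor. After commuting it past `∂̄_ξ`, this second
  -- integration by parts turns the remaining term into the square of `∂̄_ξ η`.
  have hB := integral_mul_dDir hD hw hconj1 hconj_c (hconj_s.trans hs) ξ
  have hE : ∀ z, dbarDir ξ (chernDir ξ Φ η) z * (conj (η z) * (Real.exp (-Φ z) : ℂ)) =
      dDir ξ (fun z => dbarDir ξ η z * (Real.exp (-Φ z) : ℂ)) z * conj (η z) -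
        (leviForm Φ z ξ : ℂ) * (η z * (conj (η z) * (Real.exp (-Φ z) : ℂ))) := by
    intro z
    by_cases hz : z ∈ tsupport η
    · have hz' := hΦa z (hs hz)
      rw [dbarDir_chernDir hz' hη, dDir_mul (hη1.differentiable one_ne_zero z)
        ((contDiffAt_exp_neg hz').differentiableAt (by norm_num)),
        dDir_exp_neg (hz'.differentiableAt (by norm_num)), chernDir]
      ring
    · simp [image_eq_zero_of_notMem_tsupport hz]
  have i1 : Integrable fun z =>
      dDir ξ (fun z => dbarDir ξ η z * (Real.exp (-Φ z) : ℂ)) z * conj (η z) := by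
    refine integrable_mul_of_tsupport_subset hD ?_ hconj1.continuous.continuousOn hconj_c
      (hconj_s.trans hs)
    have h := hw.continuousOn_fderiv_of_isOpen hD le_rfl
    exact continuousOn_const.mul ((h.clm_apply continuousOn_const).sub
      (continuousOn_const.mul (h.clm_apply continuousOn_const)))
  have i2 : Integrable fun z =>
      (leviForm Φ z ξ : ℂ) * (η z * (conj (η z) * (Real.exp (-Φ z) : ℂ))) := by
    have h1 : ContinuousOn (fun z => (leviForm Φ z ξ : ℂ) * η z * (Real.exp (-Φ z) : ℂ)) D := by
      have h := (contDiffOn_fderiv hD hΦ).continuousOn_fderiv_of_isOpen hD le_rfl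
      have h2 : ContinuousOn (fun z => leviForm Φ z ξ) D :=
        continuousOn_const.mul (((h.clm_apply continuousOn_const).clm_apply
          continuousOn_const).add ((h.clm_apply continuousOn_const).clm_apply continuousOn_const))
      have h3 : ContinuousOn (fun z => (leviForm Φ z ξ : ℂ)) D :=
        Complex.continuous_ofReal.comp_continuousOn h2
      exact (h3.mul hη.continuous.continuousOn).mul fun z hz =>
        (contDiffAt_exp_neg (hΦa z hz)).continuousAt.continuousWithinAt
    refine (integrable_mul_of_tsupport_subset hD h1 hconj1.continuous.continuousOn hconj_c
      (hconj_s.trans hs)).congr (Eventually.of_forall fun z => ?_)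
    simp only
    ring
  simp only [hE] at hA
  rw [hA, integral_sub i1 i2, neg_sub, sub_eq_add_neg, ← hB]
  simp only [dDir_conj]
  congr 2
  funext z
  ring

lemma bochnerKodaira (hD : IsOpen D) (hΦ : ContDiffOn ℝ 2 Φ D) (hη : ContDiff ℝ 2 η)
    (hc : HasCompactSupport η) (hs : tsupport η ⊆ D) (ξ : Fin n → ℂ) :
    ∫ z, ‖chernDir ξ Φ η z‖ ^ 2 * Real.exp (-Φ z) =
      (∫ z, leviForm Φ z ξ * (‖η z‖ ^ 2 * Real.exp (-Φ z))) +
        ∫ z, ‖dbarDir ξ η z‖ ^ 2 * Real.exp (-Φ z) := by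
  have h := bochnerKodaira_complex hD hΦ hη hc hs ξ
  simp only [← mul_assoc, Complex.mul_conj, Complex.normSq_eq_norm_sq] at h
  simp only [mul_assoc (leviForm Φ _ ξ : ℂ)] at h
  simp only [← Complex.ofReal_mul, integral_complex_ofReal, ← Complex.ofReal_add] at h
  have h' := Complex.ofReal_injective h
  simpa only [mul_assoc] using h'

end BochnerKodaira

end

/-! ### The quadratic weight -/

section

open Set Filter Topology Metric ComplexConjugate

variable {n : ℕ}

section QuadraticWeight

/-- The weight `s |z - a|²`. -/
noncomputable def quadWeight (s : ℝ) (a z : Fin n → ℂ) : ℝ := s * ∑ j, ‖z j - a j‖ ^ 2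

lemma contDiff_quadWeight (s : ℝ) (a : Fin n → ℂ) {m : WithTop ℕ∞} :
    ContDiff ℝ m (quadWeight s a) := by
  refine contDiff_const.mul (ContDiff.sum fun j _ => ContDiff.norm_sq ℝ ?_)
  exact (contDiff_apply ℝ ℂ j).sub contDiff_const

lemma hasFDerivAt_re_mul_sum (a v z : Fin n → ℂ) :
    HasFDerivAt (fun y : Fin n → ℂ => ∑ j, (conj (y j - a j) * v j).re)
      (∑ j, (v j).re • Complex.reCLM.comp (ContinuousLinearMap.proj (R := ℝ) j) +
        ∑ j, (v j).im • Complex.imCLM.comp (ContinuousLinearMap.proj (R := ℝ) j)) z := by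
  set L : (Fin n → ℂ) →L[ℝ] ℝ :=
    ∑ j, (v j).re • Complex.reCLM.comp (ContinuousLinearMap.proj (R := ℝ) j) +
        ∑ j, (v j).im • Complex.imCLM.comp (ContinuousLinearMap.proj (R := ℝ) j) with hL
  have : (fun y : Fin n → ℂ => ∑ j, (conj (y j - a j) * v j).re) = fun y => L (y - a) := by
    funext y
    simp only [hL, add_apply, sum_apply, smul_apply, ContinuousLinearMap.comp_apply,
      ContinuousLinearMap.proj_apply, Complex.reCLM_apply, Complex.imCLM_apply, smul_eq_mul,
      ← Finset.sum_add_distrib, Pi.sub_apply]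
    refine Finset.sum_congr rfl fun j _ => ?_
    simp only [Complex.mul_re, Complex.conj_re, Complex.conj_im]
    ring
  rw [this]
  exact L.hasFDerivAt.comp z ((hasFDerivAt_id z).sub_const a)

lemma fderiv_quadWeight (s : ℝ) (a z v : Fin n → ℂ) :
    fderiv ℝ (quadWeight s a) z v = 2 * s * ∑ j, (conj (z j - a j) * v j).re := by
  have h1 : ∀ j, HasFDerivAt (fun y : Fin n → ℂ => ‖y j - a j‖ ^ 2)
      ((2 : ℕ) • (innerSL ℝ (z j - a j)).comp (ContinuousLinearMap.proj (R := ℝ) j)) z := by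
    intro j
    have h2 : HasFDerivAt (fun y : Fin n → ℂ => y j - a j)
        (ContinuousLinearMap.proj (R := ℝ) j) z := (hasFDerivAt_apply j z).sub_const (a j)
    exact h2.norm_sq
  have h3 : HasFDerivAt (quadWeight s a) _ z :=
    (HasFDerivAt.fun_sum (u := Finset.univ) fun j _ => h1 j).const_mul s
  rw [h3.fderiv]
  simp only [smul_apply, sum_apply, ContinuousLinearMap.comp_apply,
    ContinuousLinearMap.proj_apply, innerSL_apply_apply, Complex.inner, smul_eq_mul,
    nsmul_eq_mul, Nat.cast_ofNat]
  rw [← Finset.mul_sum]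
  have : ∀ j, (v j * conj (z j - a j)).re = (conj (z j - a j) * v j).re := fun j => by
    rw [mul_comm]
  simp only [this]
  ring

lemma leviForm_quadWeight (s : ℝ) (a z ξ : Fin n → ℂ) :
    leviForm (quadWeight s a) z ξ = s * ∑ j, ‖ξ j‖ ^ 2 := by
  have h : ∀ v, fderiv ℝ (fderiv ℝ (quadWeight s a)) z v v = 2 * s * ∑ j, ‖v j‖ ^ 2 := by
    intro v
    rw [← fderiv_fderiv_apply (contDiff_quadWeight s a).contDiffAt]
    simp only [fderiv_quadWeight]
    rw [((hasFDerivAt_re_mul_sum a v z).const_mul (2 * s)).fderiv]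
    simp only [smul_apply, add_apply, sum_apply, ContinuousLinearMap.comp_apply,
      ContinuousLinearMap.proj_apply, Complex.reCLM_apply, Complex.imCLM_apply, smul_eq_mul,
      ← Finset.sum_add_distrib, Complex.sq_norm, Complex.normSq_apply]
  rw [leviForm, h, h]
  simp only [Pi.smul_apply, norm_smul, Complex.norm_I, one_mul]
  ring

lemma leviForm_add {φ ψ : (Fin n → ℂ) → ℝ} {z : Fin n → ℂ} (hφ : ContDiffAt ℝ 2 φ z)
    (hψ : ContDiffAt ℝ 2 ψ z) (ξ : Fin n → ℂ) :
    leviForm (fun y => φ y + ψ y) z ξ = leviForm φ z ξ + leviForm ψ z ξ := by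
  have h : ∀ v, fderiv ℝ (fderiv ℝ fun y => φ y + ψ y) z v v =
      fderiv ℝ (fderiv ℝ φ) z v v + fderiv ℝ (fderiv ℝ ψ) z v v := by
    intro v
    have h1 : (fderiv ℝ fun y => φ y + ψ y) =ᶠ[𝓝 z] fun y => fderiv ℝ φ y + fderiv ℝ ψ y := by
      filter_upwards [hφ.eventually (by simp), hψ.eventually (by simp)] with y h1 h2
      exact fderiv_fun_add (h1.differentiableAt (by norm_num)) (h2.differentiableAt (by norm_num))
    rw [h1.fderiv_eq, fderiv_fun_add (differentiableAt_fderiv hφ) (differentiableAt_fderiv hψ)]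
    rfl
  rw [leviForm, leviForm, leviForm, h, h]
  ring

lemma isPSH_quadWeight {D : Set (Fin n → ℂ)} (hD : IsOpen D) {s : ℝ} (hs : 0 ≤ s)
    (a : Fin n → ℂ) : IsPSH D (quadWeight s a) := by
  refine isPSH_of_leviForm_nonneg hD (contDiff_quadWeight s a).contDiffOn fun z _ ξ => ?_
  rw [leviForm_quadWeight]
  positivity

lemma dz_eq_dDir (j : Fin n) (u : (Fin n → ℂ) → ℂ) (z : Fin n → ℂ) :
    dz j u z = dDir (Pi.single j 1) u z := by
  rw [dz, dDir, ← Pi.single_smul', smul_eq_mul, mul_one]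

lemma ddbar_quadWeight (s : ℝ) (a z : Fin n → ℂ) (j l : Fin n) :
    ddbar (quadWeight s a) z j l = if j = l then (s : ℂ) else 0 := by
  have h1 : (dzbar l fun w => (quadWeight s a w : ℂ)) = fun w => (s : ℂ) * (w l - a l) := by
    funext w
    have hd : DifferentiableAt ℝ (quadWeight s a) w :=
      (contDiff_quadWeight s a (m := 1)).differentiable (by norm_num) w
    rw [dzbar, fderiv_ofReal_comp hd, fderiv_ofReal_comp hd, fderiv_quadWeight, fderiv_quadWeight]
    simp only [Pi.single_apply]
    simp only [mul_ite, mul_zero, mul_one, apply_ite Complex.re, Complex.zero_re,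
      Finset.sum_ite_eq', Finset.mem_univ, if_true]
    apply Complex.ext <;> simp <;> ring
  have h2 : HasFDerivAt (fun w : Fin n → ℂ => (s : ℂ) * (w l - a l))
      ((s : ℂ) • ContinuousLinearMap.proj (R := ℂ) (φ := fun _ : Fin n => ℂ) l) z :=
    ((hasFDerivAt_apply l z).sub_const (a l)).const_mul (s : ℂ)
  rw [ddbar, h1, dz_eq_dDir, dDir_of_differentiableAt h2.differentiableAt, h2.fderiv]
  simp [Pi.single_apply, eq_comm]

end QuadraticWeight

end

/-! ### The curvature operator and Skoda density of the pair `(1, εp)` -/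

section

open Set Filter Topology Metric ComplexConjugate

variable {n : ℕ}

section RankOne

variable {k : ℕ}

/-- Reduces Nakano positivity to positivity of the operator on `(n,1)`-forms, so that one spectral
computation serves both the positivity condition and the inverse. -/
lemma sum_eq_inner_curvOp (c : EndForm n k) (u : Fin n → Fin k → ℂ) :
    ∑ j, ∑ l, ∑ lam, ∑ mu, c j l lam mu * u j lam * conj (u l mu) =
      inner ℂ (WithLp.toLp 2 fun p : Fin n × Fin k => u p.1 p.2)
        (curvOp c (WithLp.toLp 2 fun p : Fin n × Fin k => u p.1 p.2)) := by
  simp only [PiLp.inner_apply, curvOp_apply, RCLike.inner_apply, Fintype.sum_prod_type,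
    Finset.sum_mul]
  rw [Finset.sum_comm]
  refine Finset.sum_congr rfl fun l _ => ?_
  rw [Finset.sum_comm' (t' := Finset.univ) (s' := fun _ => Finset.univ) (by simp)]
  conv_rhs => rw [Finset.sum_comm]
  rw [Finset.sum_comm]
  refine Finset.sum_congr rfl fun j _ => ?_
  rw [Finset.sum_comm]

/-- A scalar minus a rank one operator of smaller norm: positivity, and the inverse on the
range. -/
lemma scalar_sub_rankOne {E : Type*} [NormedAddCommGroup E] [InnerProductSpace ℂ E]
    [FiniteDimensional ℂ E] {T : Module.End ℂ E} {s G : ℝ} {B : E} (hG : 0 < G)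
    (hT : ∀ u, T u = (s : ℂ) • u - ((1 / G : ℝ) : ℂ) • (inner ℂ B u : ℂ) • B)
    (hB : ‖B‖ ^ 2 / G < s) :
    (∀ u, u ≠ 0 → 0 < (inner ℂ u (T u)).re) ∧
      Ring.inverse T B = ((1 / (s - ‖B‖ ^ 2 / G) : ℝ) : ℂ) • B := by
  have hpos : ∀ u, u ≠ 0 → 0 < (inner ℂ u (T u)).re := by
    intro u hu
    have h1 : inner ℂ u (T u) = ((s * ‖u‖ ^ 2 - (1 / G) * ‖(inner ℂ B u : ℂ)‖ ^ 2 : ℝ) : ℂ) := by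
      rw [hT, inner_sub_right, inner_smul_right, inner_smul_right, inner_smul_right,
        inner_self_eq_norm_sq_to_K, ← inner_conj_symm u B, Complex.mul_conj,
        Complex.normSq_eq_norm_sq]
      push_cast
      rfl
    have h2 : ‖(inner ℂ B u : ℂ)‖ ^ 2 ≤ ‖B‖ ^ 2 * ‖u‖ ^ 2 := by
      rw [← mul_pow]
      exact pow_le_pow_left₀ (norm_nonneg _) (norm_inner_le_norm B u) 2
    have h3 : 0 < ‖u‖ ^ 2 := by positivity
    rw [h1, Complex.ofReal_re]
    have h4 : (1 / G) * ‖(inner ℂ B u : ℂ)‖ ^ 2 ≤ (1 / G) * (‖B‖ ^ 2 * ‖u‖ ^ 2) := by gcongr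
    have h5 : (1 / G) * (‖B‖ ^ 2 * ‖u‖ ^ 2) = (‖B‖ ^ 2 / G) * ‖u‖ ^ 2 := by ring
    have h6 := mul_lt_mul_of_pos_right hB h3
    linarith
  refine ⟨hpos, ?_⟩
  have hunit : IsUnit T := by
    rw [LinearMap.isUnit_iff_ker_eq_bot, LinearMap.ker_eq_bot']
    intro u hu
    by_contra h
    have := hpos u h
    rw [hu, inner_zero_right] at this
    simp at this
  have hne : s - ‖B‖ ^ 2 / G ≠ 0 := by linarith
  -- `B` is an eigenvector of `T` with eigenvalue `s - ‖B‖²/G`, the only eigenvalue the density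
  -- needs.
  have h1 : T (((1 / (s - ‖B‖ ^ 2 / G) : ℝ) : ℂ) • B) = B := by
    have h2 : T B = ((s - ‖B‖ ^ 2 / G : ℝ) : ℂ) • B := by
      rw [hT, inner_self_eq_norm_sq_to_K, smul_smul, ← sub_smul]
      congr 1
      push_cast
      simp
      ring
    rw [map_smul, h2, smul_smul, ← Complex.ofReal_mul, one_div_mul_cancel hne]
    simp
  calc Ring.inverse T B = Ring.inverse T (T (((1 / (s - ‖B‖ ^ 2 / G) : ℝ) : ℂ) • B)) := by rw [h1]
    _ = (Ring.inverse T * T) (((1 / (s - ‖B‖ ^ 2 / G) : ℝ) : ℂ) • B) := rfl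
    _ = _ := by rw [Ring.inverse_mul_cancel _ hunit]; rfl

end RankOne

/-- The linear form `∑ ξ̄_j (z_j - a_j)`. -/
noncomputable def linForm (ξ a z : Fin n → ℂ) : ℂ := ∑ j, conj (ξ j) * (z j - a j)

/-- The pair `(1, ε p)` with `p = ∑ ξ̄_j (z_j - a_j)`. -/
noncomputable def linPair (ξ a : Fin n → ℂ) (ε : ℝ) : Fin 2 → (Fin n → ℂ) → ℂ :=
  ![fun _ => 1, fun z => ε * linForm ξ a z]

section LinPair

variable (ξ a : Fin n → ℂ) (ε s : ℝ) (z : Fin n → ℂ)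

lemma hasFDerivAt_linForm : HasFDerivAt (linForm ξ a)
    (∑ j, conj (ξ j) • ContinuousLinearMap.proj (R := ℂ) (φ := fun _ : Fin n => ℂ) j) z :=
  HasFDerivAt.fun_sum fun j _ => ((hasFDerivAt_apply j z).sub_const (a j)).const_mul (conj (ξ j))

lemma differentiable_linForm : Differentiable ℂ (linForm ξ a) := fun z =>
  (hasFDerivAt_linForm ξ a z).differentiableAt

lemma dDir_linForm (η : Fin n → ℂ) : dDir η (linForm ξ a) z = ∑ j, conj (ξ j) * η j := by
  rw [dDir_of_differentiableAt (differentiable_linForm ξ a z), (hasFDerivAt_linForm ξ a z).fderiv]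
  simp [sum_apply]

lemma differentiable_linPair (lam : Fin 2) : Differentiable ℂ (linPair ξ a ε lam) := by
  fin_cases lam
  · exact differentiable_const _
  · exact (differentiable_linForm ξ a).const_mul _

lemma normSqTuple_linPair :
    normSqTuple (linPair ξ a ε) z = 1 + ε ^ 2 * ‖linForm ξ a z‖ ^ 2 := by
  simp [normSqTuple, linPair, mul_pow]

lemma one_le_normSqTuple_linPair : 1 ≤ normSqTuple (linPair ξ a ε) z := by
  rw [normSqTuple_linPair]
  nlinarith [mul_nonneg (sq_nonneg ε) (sq_nonneg ‖linForm ξ a z‖)]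

lemma normSqTuple_linPair_coe : (fun w => (normSqTuple (linPair ξ a ε) w : ℂ)) =
    fun w => 1 + (ε : ℂ) ^ 2 * (linForm ξ a w * conj (linForm ξ a w)) := by
  funext w
  rw [normSqTuple_linPair, Complex.mul_conj, Complex.normSq_eq_norm_sq]
  push_cast
  ring

/-- The product rule applied to `(u / v) * v`, which agrees with `u` near `z`. -/
lemma dDir_div {η : Fin n → ℂ} {u v : (Fin n → ℂ) → ℂ} (hu : DifferentiableAt ℝ u z)
    (hv : DifferentiableAt ℝ v z) (h0 : v z ≠ 0) :
    dDir η (fun w => u w / v w) z = (dDir η u z - u z / v z * dDir η v z) / v z := by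
  have h1 : DifferentiableAt ℝ (fun w => u w / v w) z := by
    simpa only [div_eq_mul_inv] using hu.fun_mul (hv.fun_inv h0)
  have h2 := dDir_mul (ξ := η) h1 hv
  have h3 : (fun y => u y / v y * v y) =ᶠ[𝓝 z] u := by
    filter_upwards [hv.continuousAt.eventually_ne h0] with y hy
    exact div_mul_cancel₀ _ hy
  have h4 : dDir η (fun y => u y / v y * v y) z = dDir η u z := by
    rw [dDir, dDir, h3.fderiv_eq]
  rw [h4] at h2
  rw [h2]
  field_simp
  ring

lemma dDir_const (c : ℂ) (η : Fin n → ℂ) : dDir η (fun _ => c) z = 0 := by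
  simp [dDir]

lemma differentiableAt_normSqTuple_linPair :
    DifferentiableAt ℝ (fun w => (normSqTuple (linPair ξ a ε) w : ℂ)) z := by
  rw [normSqTuple_linPair_coe]
  have h1 : DifferentiableAt ℝ (linForm ξ a) z :=
    (differentiable_linForm ξ a z).restrictScalars ℝ
  have h2 : DifferentiableAt ℝ (fun w => conj (linForm ξ a w)) z :=
    Complex.conjCLE.differentiableAt.comp z h1
  exact ((h1.fun_mul h2).const_mul _).const_add _

lemma dDir_normSqTuple_linPair (η : Fin n → ℂ) :
    dDir η (fun w => (normSqTuple (linPair ξ a ε) w : ℂ)) z =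
      (ε : ℂ) ^ 2 * conj (linForm ξ a z) * dDir η (linForm ξ a) z := by
  have h1 : DifferentiableAt ℝ (linForm ξ a) z :=
    (differentiable_linForm ξ a z).restrictScalars ℝ
  have h2 : DifferentiableAt ℝ (fun w => conj (linForm ξ a w)) z :=
    Complex.conjCLE.differentiableAt.comp z h1
  have h3 : dDir η (fun w => 1 + (ε : ℂ) ^ 2 * (linForm ξ a w * conj (linForm ξ a w))) z =
      dDir η (fun w => (ε : ℂ) ^ 2 * (linForm ξ a w * conj (linForm ξ a w))) z := by
    simp only [dDir, fderiv_const_add]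
  rw [normSqTuple_linPair_coe, h3, dDir_mul (differentiableAt_const _) (h1.fun_mul h2),
    dDir_mul h1 h2, dDir_conj, dbarDir_of_differentiableAt (differentiable_linForm ξ a z),
    dDir_const]
  simp
  ring

/-- The value part of `β` for the pair `(1, ε p)`. -/
noncomputable def linPairBeta : Fin 2 → ℂ :=
  ![(ε : ℂ) ^ 2 * conj (linForm ξ a z) / (normSqTuple (linPair ξ a ε) z : ℂ),
    -(ε : ℂ) / (normSqTuple (linPair ξ a ε) z : ℂ)]

lemma beta_linPair (j : Fin n) (lam : Fin 2) :
    beta (linPair ξ a ε) z j lam = conj (ξ j) * linPairBeta ξ a ε z lam := by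
  have hG : (normSqTuple (linPair ξ a ε) z : ℂ) ≠ 0 := by
    have := one_le_normSqTuple_linPair ξ a ε z
    exact_mod_cast (by linarith : normSqTuple (linPair ξ a ε) z ≠ 0)
  have hp : dDir (Pi.single j 1) (linForm ξ a) z = conj (ξ j) := by
    simp [dDir_linForm, Pi.single_apply]
  have hG2 := congrFun (normSqTuple_linPair_coe ξ a ε) z
  rw [beta, dz_eq_dDir, dDir_div z ((differentiable_linPair ξ a ε lam z).restrictScalars ℝ)
    (differentiableAt_normSqTuple_linPair ξ a ε z) hG, dDir_normSqTuple_linPair, hp]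
  fin_cases lam
  · simp only [linPair, linPairBeta, Fin.zero_eta, Matrix.cons_val_zero, dDir_const] at hG ⊢
    field_simp
    ring
  · have h1 : DifferentiableAt ℝ (linForm ξ a) z :=
      (differentiable_linForm ξ a z).restrictScalars ℝ
    have h2 : dDir (Pi.single j 1) (linPair ξ a ε 1) z = ε * conj (ξ j) := by
      have : linPair ξ a ε 1 = fun z => (ε : ℂ) * linForm ξ a z := rfl
      rw [this, dDir_mul (differentiableAt_const _) h1, dDir_const, hp]
      ring
    have h3 : linPair ξ a ε 1 z = ε * linForm ξ a z := rfl
    have h4 : linPairBeta ξ a ε z 1 = -(ε : ℂ) / (normSqTuple (linPair ξ a ε) z : ℂ) := rfl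
    simp only [Fin.mk_one, h2, h3, h4]
    field_simp
    rw [hG2]
    ring

/-- The numerator `ε⁴|p|² + ε²` is `ε²|g|²`, which removes one of the two factors `|g|²` below. -/
lemma sum_norm_sq_linPairBeta :
    ∑ lam, ‖linPairBeta ξ a ε z lam‖ ^ 2 = ε ^ 2 / normSqTuple (linPair ξ a ε) z := by
  have h1 := one_le_normSqTuple_linPair ξ a ε z
  have h0 : normSqTuple (linPair ξ a ε) z ≠ 0 := by linarith
  have h2 : ε ^ 2 / normSqTuple (linPair ξ a ε) z =
      ε ^ 2 * (1 + ε ^ 2 * ‖linForm ξ a z‖ ^ 2) / normSqTuple (linPair ξ a ε) z ^ 2 := by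
    rw [← normSqTuple_linPair]
    field_simp
  rw [h2, Fin.sum_univ_two]
  simp only [linPairBeta, Matrix.cons_val_zero, Matrix.cons_val_one, norm_div, norm_mul, norm_pow,
    norm_neg, Complex.norm_real, Real.norm_eq_abs, sq_abs, div_pow, RCLike.norm_conj, mul_pow]
  ring

/-- The vector `ξ ⊗ b̄`, where `b` is the value part of `β`. -/
noncomputable def linPairVec : EuclideanSpace ℂ (Fin n × Fin 2) :=
  WithLp.toLp 2 fun p => ξ p.1 * conj (linPairBeta ξ a ε z p.2)

lemma norm_sq_linPairVec : ‖linPairVec ξ a ε z‖ ^ 2 =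
    (∑ j, ‖ξ j‖ ^ 2) * (ε ^ 2 / normSqTuple (linPair ξ a ε) z) := by
  rw [EuclideanSpace.norm_sq_eq, Fintype.sum_prod_type, ← sum_norm_sq_linPairBeta,
    Finset.sum_mul_sum]
  simp [linPairVec, mul_pow]

/-- `β* ∧ dz` is a multiple of the vector spanning the range of the rank-one part, so the inverse
curvature operator is needed on that line only. -/
lemma betaStarDz_linPair : betaStarDz (linPair ξ a ε) z =
    ((-1) ^ n / (normSqTuple (linPair ξ a ε) z : ℂ)) • linPairVec ξ a ε z := by
  ext p
  simp only [betaStarDz, betaStar, beta_linPair, linPairVec, PiLp.smul_apply, smul_eq_mul, map_mul,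
    Complex.conj_conj]
  ring

/-- `∂∂̄ψ` is `s` times the identity matrix, and `β = (∑ ξ̄_j dz_j) ⊗ b` is decomposable, so `β* ∧
β` acts with rank one. -/
lemma curvOp_linPair (u : EuclideanSpace ℂ (Fin n × Fin 2)) :
    curvOp (curvForm (quadWeight s a) (linPair ξ a ε) z) u = (s : ℂ) • u -
      ((1 / normSqTuple (linPair ξ a ε) z : ℝ) : ℂ) •
        (inner ℂ (linPairVec ξ a ε z) u : ℂ) • linPairVec ξ a ε z := by
  ext ⟨l, mu⟩
  have h1 : ∀ j lam, curvForm (quadWeight s a) (linPair ξ a ε) z j l lam mu =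
      (if lam = mu then (if j = l then (s : ℂ) else 0) else 0) -
        ξ l * conj (linPairBeta ξ a ε z mu) / (normSqTuple (linPair ξ a ε) z : ℂ) *
          (conj (ξ j) * linPairBeta ξ a ε z lam) := by
    intro j lam
    simp only [curvForm, Pi.add_apply, ddbarId, betaStarWedgeBeta, betaStar, beta_linPair,
      ddbar_quadWeight, map_mul, Complex.conj_conj, sub_eq_add_neg]
  rw [curvOp_apply]
  simp only [h1, PiLp.sub_apply, PiLp.smul_apply, smul_eq_mul, PiLp.inner_apply,
    RCLike.inner_apply, Fintype.sum_prod_type, linPairVec, sub_mul, Finset.sum_sub_distrib,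
    map_mul, Complex.conj_conj]
  congr 1
  · simp [ite_mul]
  · simp only [Finset.sum_mul, Finset.mul_sum]
    refine Finset.sum_congr rfl fun j _ => Finset.sum_congr rfl fun lam _ => ?_
    push_cast
    ring

variable {s ε}

lemma norm_sq_linPairVec_div_le :
    ‖linPairVec ξ a ε z‖ ^ 2 / normSqTuple (linPair ξ a ε) z ≤ ε ^ 2 * ∑ j, ‖ξ j‖ ^ 2 := by
  have h1 := one_le_normSqTuple_linPair ξ a ε z
  rw [norm_sq_linPairVec]
  have hN : 0 ≤ ∑ j, ‖ξ j‖ ^ 2 := by positivity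
  rw [div_le_iff₀ (by linarith), mul_div_assoc', div_le_iff₀ (by linarith)]
  have h2 : 0 ≤ ε ^ 2 * ∑ j, ‖ξ j‖ ^ 2 := by positivity
  nlinarith [mul_nonneg h2 (by nlinarith : 0 ≤ normSqTuple (linPair ξ a ε) z ^ 2 - 1)]

/-- The rank-one perturbation has norm at most `ε²N`, which `s` dominates. -/
lemma nakanoPos_linPair (hs : ε ^ 2 * ∑ j, ‖ξ j‖ ^ 2 < s) :
    NakanoPos (curvForm (quadWeight s a) (linPair ξ a ε) z) := by
  intro u hu
  have h1 := one_le_normSqTuple_linPair ξ a ε z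
  rw [sum_eq_inner_curvOp]
  refine (scalar_sub_rankOne (by linarith) (curvOp_linPair ξ a ε s z)
    ((norm_sq_linPairVec_div_le ξ a (ε := ε) z).trans_lt hs)).1 _ fun h => hu ?_
  funext j lam
  simpa using congrArg (fun v : EuclideanSpace ℂ (Fin n × Fin 2) => v (j, lam)) h

/-- The Skoda density of the pair `(1, ε p)` up to terms of order `ε⁴`. -/
lemma skodaDensity_linPair_le (hs : ε ^ 2 * ∑ j, ‖ξ j‖ ^ 2 < s) :
    skodaDensity (quadWeight s a) (linPair ξ a ε) z ≤
      1 - ε ^ 2 * ‖linForm ξ a z‖ ^ 2 + ε ^ 4 * ‖linForm ξ a z‖ ^ 4 +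
        ε ^ 2 * (∑ j, ‖ξ j‖ ^ 2) / (s - ε ^ 2 * ∑ j, ‖ξ j‖ ^ 2) := by
  have h1 := one_le_normSqTuple_linPair ξ a ε z
  have hlt := norm_sq_linPairVec_div_le ξ a (ε := ε) z
  have hinv := (scalar_sub_rankOne (by linarith) (curvOp_linPair ξ a ε s z) (hlt.trans_lt hs)).2
  have hnormG := normSqTuple_linPair ξ a ε z
  set G := normSqTuple (linPair ξ a ε) z with hG
  set B := linPairVec ξ a ε z with hB
  have hG0 : 0 < G := by linarith
  have hinner : (inner ℂ (betaStarDz (linPair ξ a ε) z) (Ring.inverse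
      (curvOp (curvForm (quadWeight s a) (linPair ξ a ε) z)) (betaStarDz (linPair ξ a ε) z))).re =
      (1 / G ^ 2) * (‖B‖ ^ 2 / (s - ‖B‖ ^ 2 / G)) := by
    rw [betaStarDz_linPair, map_smul, hinv, inner_smul_left, inner_smul_right, inner_smul_right,
      inner_self_eq_norm_sq_to_K]
    have h2 : conj ((-1 : ℂ) ^ n / (G : ℂ)) * ((-1) ^ n / (G : ℂ)) = ((1 / G ^ 2 : ℝ) : ℂ) := by
      rw [map_div₀, map_pow, map_neg, map_one, Complex.conj_ofReal, div_mul_div_comm, ← mul_pow]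
      push_cast
      simp [sq]
    rw [← hG, ← hB, ← mul_assoc, h2]
    have h3 : ((1 / G ^ 2 : ℝ) : ℂ) * (((1 / (s - ‖B‖ ^ 2 / G) : ℝ) : ℂ) * (‖B‖ : ℂ) ^ 2) =
        (((1 / G ^ 2) * (‖B‖ ^ 2 / (s - ‖B‖ ^ 2 / G)) : ℝ) : ℂ) := by
      push_cast
      ring
    exact (congrArg Complex.re h3).trans (Complex.ofReal_re _)
  rw [skodaDensity, hinner]
  -- With `x = ε²|p|²` this is `1/(1 + x) ≤ 1 - x + x²`, from `(1 + x)(1 - x + x²) = 1 + x³`.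
  have hA : 1 / G ≤ 1 - ε ^ 2 * ‖linForm ξ a z‖ ^ 2 + ε ^ 4 * ‖linForm ξ a z‖ ^ 4 := by
    rw [div_le_iff₀ hG0, hnormG]
    have : 0 ≤ (ε ^ 2 * ‖linForm ξ a z‖ ^ 2) ^ 3 := by positivity
    nlinarith
  have hBle : ‖B‖ ^ 2 ≤ ε ^ 2 * ∑ j, ‖ξ j‖ ^ 2 := by
    rw [norm_sq_linPairVec, mul_comm (ε ^ 2)]
    exact mul_le_mul_of_nonneg_left (div_le_self (sq_nonneg ε) h1) (by positivity)
  have hC : ‖B‖ ^ 2 / (s - ‖B‖ ^ 2 / G) ≤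
      ε ^ 2 * (∑ j, ‖ξ j‖ ^ 2) / (s - ε ^ 2 * ∑ j, ‖ξ j‖ ^ 2) := by
    refine div_le_div₀ (by positivity) hBle (by linarith) (by linarith)
  have hC0 : 0 ≤ ‖B‖ ^ 2 / (s - ‖B‖ ^ 2 / G) := div_nonneg (by positivity) (by linarith)
  have hD : (1 / G ^ 2) * (‖B‖ ^ 2 / (s - ‖B‖ ^ 2 / G)) ≤ ‖B‖ ^ 2 / (s - ‖B‖ ^ 2 / G) := by
    refine mul_le_of_le_one_left hC0 ?_
    rw [div_le_one (by positivity)]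
    exact one_le_pow₀ h1
  linarith

end LinPair

end

/-! ### From division to an L² estimate for `∂̄_ξ` -/

section

open Set Filter Topology Metric ComplexConjugate

variable {n : ℕ}

section Estimate

variable {D : Set (Fin n → ℂ)} {φ : (Fin n → ℂ) → ℝ} {f : (Fin n → ℂ) → ℂ}

lemma continuousOn_norm_sq_mul_exp {u : (Fin n → ℂ) → ℂ} (hu : ContinuousOn u D)
    (hφ : ContinuousOn φ D) : ContinuousOn (fun z => ‖u z‖ ^ 2 * Real.exp (-φ z)) D :=
  (hu.norm.pow 2).mul (Real.continuous_exp.comp_continuousOn hφ.neg)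

lemma integrableOn_of_mem_bergmanSpace (hD : IsOpen D) (hφ : ContinuousOn φ D)
    (hf : f ∈ bergmanSpace D φ) : IntegrableOn (fun z => ‖f z‖ ^ 2 * Real.exp (-φ z)) D := by
  refine (lintegral_ofReal_ne_top_iff_integrable ?_ ?_).1 hf.2.ne
  · exact (continuousOn_norm_sq_mul_exp hf.1.continuousOn hφ).aestronglyMeasurable hD.measurableSet
  · exact Eventually.of_forall fun z => by positivity

lemma quadWeight_nonneg {s : ℝ} (hs : 0 ≤ s) (a z : Fin n → ℂ) : 0 ≤ quadWeight s a z :=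
  mul_nonneg hs (by positivity)

lemma continuousOn_add_quadWeight (hφ : ContinuousOn φ D) (s : ℝ) (a : Fin n → ℂ) :
    ContinuousOn (fun z => φ z + quadWeight s a z) D :=
  hφ.add (contDiff_quadWeight s a (m := 0)).continuous.continuousOn

lemma integrableOn_add_quadWeight (hD : IsOpen D) (hφ : ContinuousOn φ D)
    (hf : f ∈ bergmanSpace D φ) {s : ℝ} (hs : 0 ≤ s) (a : Fin n → ℂ) :
    IntegrableOn (fun z => ‖f z‖ ^ 2 * Real.exp (-(φ z + quadWeight s a z))) D := by
  refine (integrableOn_of_mem_bergmanSpace hD hφ hf).mono' ?_ ?_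
  · exact (continuousOn_norm_sq_mul_exp hf.1.continuousOn
      (continuousOn_add_quadWeight hφ s a)).aestronglyMeasurable hD.measurableSet
  · refine Eventually.of_forall fun z => ?_
    rw [Real.norm_of_nonneg (by positivity)]
    gcongr
    linarith [quadWeight_nonneg hs a z]

/-- Division of `f` by `(1, ε p)` solves `∂̄u = ∂̄(p̄ f)` with an `L²` estimate. -/
lemma exists_dbar_solution (hD : IsOpen D) (hφ : ContinuousOn φ D) (hf : f ∈ bergmanSpace D φ)
    (hdiv : IsL2Divisible D φ f) {ξ a : Fin n → ℂ} {ε s P : ℝ} (hε : 0 < ε)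
    (hs : ε ^ 2 * ∑ j, ‖ξ j‖ ^ 2 < s) (hP : ∀ z ∈ D, ‖linForm ξ a z‖ ≤ P) :
    ∃ u : (Fin n → ℂ) → ℂ, ContDiffOn ℝ 1 u D ∧
      (∀ z ∈ D, dbarDir ξ u z = -((∑ j, ‖ξ j‖ ^ 2 : ℝ) : ℂ) * f z) ∧
      IntegrableOn (fun z => ‖u z‖ ^ 2 * Real.exp (-(φ z + quadWeight s a z))) D ∧
      ∫ z in D, ‖u z‖ ^ 2 * Real.exp (-(φ z + quadWeight s a z)) ≤
        (ε ^ 2 * P ^ 4 + (∑ j, ‖ξ j‖ ^ 2) / (s - ε ^ 2 * ∑ j, ‖ξ j‖ ^ 2)) *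
          ∫ z in D, ‖f z‖ ^ 2 * Real.exp (-(φ z + quadWeight s a z)) := by
  set N : ℝ := ∑ j, ‖ξ j‖ ^ 2 with hN
  have hN0 : 0 ≤ N := by positivity
  have hs0 : 0 < s := lt_of_le_of_lt (by positivity) hs
  set κ : ℝ := N / (s - ε ^ 2 * N) with hκ
  have hκ0 : 0 ≤ κ := div_nonneg hN0 (by linarith)
  set w : (Fin n → ℂ) → ℝ := fun z => Real.exp (-(φ z + quadWeight s a z)) with hw
  have hw0 : ∀ z, 0 < w z := fun z => Real.exp_pos _
  have hΦ := continuousOn_add_quadWeight hφ s a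
  have hfw : IntegrableOn (fun z => ‖f z‖ ^ 2 * w z) D :=
    integrableOn_add_quadWeight hD hφ hf hs0.le a
  have hpc : Continuous (linForm ξ a) := (differentiable_linForm ξ a).continuous
  -- An integrable majorant of the Skoda integrand. The term `-ε²|p|²` is kept exactly, since it
  -- must cancel later; only the `ε⁴` term is coarsened by `|p| ≤ P`.
  set F : (Fin n → ℂ) → ℝ := fun z =>
    (1 - ε ^ 2 * ‖linForm ξ a z‖ ^ 2 + ε ^ 4 * P ^ 4 + ε ^ 2 * κ) * (‖f z‖ ^ 2 * w z) with hF
  have hp4 : ∀ z ∈ D, ‖linForm ξ a z‖ ^ 4 ≤ P ^ 4 := fun z hz =>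
    pow_le_pow_left₀ (norm_nonneg _) (hP z hz) 4
  have hp2 : ∀ z ∈ D, ‖linForm ξ a z‖ ^ 2 ≤ P ^ 2 := fun z hz =>
    pow_le_pow_left₀ (norm_nonneg _) (hP z hz) 2
  have hF0 : ∀ z ∈ D, 0 ≤ F z := by
    intro z hz
    refine mul_nonneg ?_ (mul_nonneg (by positivity) (hw0 z).le)
    have h1 := mul_le_mul_of_nonneg_left (hp4 z hz) (by positivity : 0 ≤ ε ^ 4)
    have h2 : 0 ≤ ε ^ 2 * κ := by positivity
    nlinarith [sq_nonneg (ε ^ 2 * ‖linForm ξ a z‖ ^ 2 - 1)]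
  have hFi : IntegrableOn F D := by
    refine Integrable.bdd_mul hfw (c := 1 + ε ^ 2 * P ^ 2 + ε ^ 4 * P ^ 4 + ε ^ 2 * κ) ?_ ?_
    · exact (by fun_prop : Continuous fun z => 1 - ε ^ 2 * ‖linForm ξ a z‖ ^ 2 + ε ^ 4 * P ^ 4 +
        ε ^ 2 * κ).aestronglyMeasurable
    · filter_upwards [ae_restrict_mem hD.measurableSet] with z hz
      have h1 := mul_le_mul_of_nonneg_left (hp2 z hz) (by positivity : 0 ≤ ε ^ 2)
      have h2 : 0 ≤ ε ^ 2 * κ := by positivity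
      have h3 : 0 ≤ ε ^ 4 * P ^ 4 := by positivity
      have h4 : 0 ≤ ε ^ 2 * ‖linForm ξ a z‖ ^ 2 := by positivity
      rw [Real.norm_eq_abs, abs_le]
      constructor <;> linarith
  have hSk : skodaIntegral D φ (quadWeight s a) (linPair ξ a ε) f ≤
      ENNReal.ofReal (∫ z in D, F z) := by
    rw [ofReal_integral_eq_lintegral_ofReal hFi
      ((ae_restrict_iff' hD.measurableSet).2 (Eventually.of_forall hF0))]
    refine setLIntegral_mono_ae' hD.measurableSet (Eventually.of_forall fun z hz => ?_)
    refine ENNReal.ofReal_le_ofReal ?_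
    have h1 := skodaDensity_linPair_le ξ a z hs
    have h2 := mul_le_mul_of_nonneg_left (hp4 z hz) (by positivity : 0 ≤ ε ^ 4)
    have h3 : -φ z - quadWeight s a z = -(φ z + quadWeight s a z) := by ring
    rw [h3, mul_assoc]
    refine mul_le_mul_of_nonneg_right ?_ (mul_nonneg (by positivity) (hw0 z).le)
    rw [← hN, mul_div_assoc] at h1
    linarith
  obtain ⟨h, hh, hfh, hle⟩ := hdiv.2 2 (linPair ξ a ε) (quadWeight s a)
    (fun lam => (differentiable_linPair ξ a ε lam).differentiableOn)
    (contDiff_quadWeight s a).contDiffOn (isPSH_quadWeight hD hs0.le a)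
    (fun z _ => ⟨0, by simp [linPair]⟩) (fun z _ => nakanoPos_linPair ξ a z hs)
    (hSk.trans_lt ENNReal.ofReal_lt_top)
  have hle' := hle.trans hSk
  set H : (Fin n → ℂ) → ℝ := fun z => normSqTuple h z * Real.exp (-φ z - quadWeight s a z) with hH
  have hH0 : ∀ z, 0 ≤ H z := fun z =>
    mul_nonneg (Finset.sum_nonneg fun _ _ => by positivity) (Real.exp_pos _).le
  have hHi : IntegrableOn H D := by
    refine (lintegral_ofReal_ne_top_iff_integrable ?_ (Eventually.of_forall hH0)).1
      (hle'.trans_lt ENNReal.ofReal_lt_top).ne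
    refine ContinuousOn.aestronglyMeasurable ?_ hD.measurableSet
    refine ContinuousOn.mul (continuousOn_finsetSum _ fun i _ => (hh i).continuousOn.norm.pow 2) ?_
    exact Real.continuous_exp.comp_continuousOn
      (hφ.neg.sub (contDiff_quadWeight s a (m := 0)).continuous.continuousOn)
  have hHF : ∫ z in D, H z ≤ ∫ z in D, F z := by
    rw [← ENNReal.ofReal_le_ofReal_iff (setIntegral_nonneg hD.measurableSet hF0),
      ofReal_integral_eq_lintegral_ofReal hHi (Eventually.of_forall hH0)]
    exact hle'
  -- Since `h₁/ε` is holomorphic, `∂̄_ξ u` comes from `-p̄f` alone and equals `-N f`.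
  set u : (Fin n → ℂ) → ℂ := fun z => h 1 z / ε - conj (linForm ξ a z) * f z with hu
  have hεc : (ε : ℂ) ≠ 0 := by exact_mod_cast hε.ne'
  have hk : DifferentiableOn ℂ (fun z => h 1 z / (ε : ℂ)) D := by
    simpa only [div_eq_mul_inv] using (hh 1).mul_const ((ε : ℂ)⁻¹)
  have hk1 : ContDiffOn ℝ 1 (fun z => h 1 z / (ε : ℂ)) D :=
    (contDiffOn_of_differentiableOn hD 1 hk).restrict_scalars ℝ
  have hf1 : ContDiffOn ℝ 1 f D := (contDiffOn_of_differentiableOn hD 1 hf.1).restrict_scalars ℝ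
  have hp1 : ContDiff ℝ 1 fun z => conj (linForm ξ a z) :=
    contDiff_conj_comp (contDiffOn_univ.1 ((contDiffOn_of_differentiableOn isOpen_univ 1
      (differentiable_linForm ξ a).differentiableOn).restrict_scalars ℝ))
  have hu1 : ContDiffOn ℝ 1 u D := hk1.sub (hp1.contDiffOn.mul hf1)
  -- Expanding `|h₀|² + |h₁|²` with `h₀ = f - εp h₁` gives `|f|² - ε²|p|²|f|² + ε²|u|² +
  -- ε²|p|²|h₁|²`. The first two terms are the leading part of `F`, and the last is non-negative and
  -- dropped.
  have hpt : ∀ z ∈ D, ε ^ 2 * (‖u z‖ ^ 2 * w z) ≤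
      H z - F z + (ε ^ 4 * P ^ 4 + ε ^ 2 * κ) * (‖f z‖ ^ 2 * w z) := by
    intro z hz
    have e1 : Real.exp (-φ z - quadWeight s a z) = w z := by
      rw [hw]; congr 1; ring
    have e2 : f z = h 0 z + ε * linForm ξ a z * h 1 z := by
      rw [hfh z hz]
      simp [linPair, Fin.sum_univ_two]
    have e3 : ‖h 0 z‖ ^ 2 + ‖h 1 z‖ ^ 2 = ‖f z‖ ^ 2 - ε ^ 2 * ‖linForm ξ a z‖ ^ 2 * ‖f z‖ ^ 2 +
        ε ^ 2 * ‖u z‖ ^ 2 + ε ^ 2 * ‖linForm ξ a z‖ ^ 2 * ‖h 1 z‖ ^ 2 := by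
      have e4 : h 0 z = f z - ε * linForm ξ a z * h 1 z := by rw [e2]; ring
      have e5 : ε ^ 2 * ‖u z‖ ^ 2 = ‖h 1 z - ε * (conj (linForm ξ a z) * f z)‖ ^ 2 := by
        have : h 1 z - ε * (conj (linForm ξ a z) * f z) = ε * u z := by
          rw [hu]; field_simp
        rw [this, norm_mul, mul_pow, Complex.norm_real, Real.norm_eq_abs, sq_abs]
      rw [e5, e4]
      simp only [Complex.sq_norm, Complex.normSq_apply, Complex.sub_re, Complex.sub_im,
        Complex.mul_re, Complex.mul_im, Complex.ofReal_re, Complex.ofReal_im, Complex.conj_re,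
        Complex.conj_im]
      ring
    have e6 : H z = (‖h 0 z‖ ^ 2 + ‖h 1 z‖ ^ 2) * w z := by
      rw [hH]
      simp only [e1, normSqTuple, Fin.sum_univ_two]
    rw [e6, e3, hF]
    have e7 : 0 ≤ ε ^ 2 * ‖linForm ξ a z‖ ^ 2 * ‖h 1 z‖ ^ 2 * w z := by
      have := (hw0 z).le
      positivity
    nlinarith
  have hRi : IntegrableOn (fun z => H z - F z +
      (ε ^ 4 * P ^ 4 + ε ^ 2 * κ) * (‖f z‖ ^ 2 * w z)) D := (hHi.sub hFi).add (hfw.const_mul _)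
  have hui' : IntegrableOn (fun z => ε ^ 2 * (‖u z‖ ^ 2 * w z)) D := by
    refine hRi.mono' ?_ ?_
    · exact (continuousOn_const.mul (continuousOn_norm_sq_mul_exp hu1.continuousOn
        hΦ)).aestronglyMeasurable hD.measurableSet
    · filter_upwards [ae_restrict_mem hD.measurableSet] with z hz
      rw [Real.norm_of_nonneg (mul_nonneg (by positivity)
        (mul_nonneg (by positivity) (hw0 z).le))]
      exact hpt z hz
  have hui : IntegrableOn (fun z => ‖u z‖ ^ 2 * w z) D := by
    have := hui'.const_mul (ε ^ 2)⁻¹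
    refine this.congr (Eventually.of_forall fun z => ?_)
    simp only
    field_simp
  refine ⟨u, hu1, fun z hz => ?_, hui, ?_⟩
  · have d1 := (hf.1.differentiableAt (hD.mem_nhds hz))
    have d2 := hk.differentiableAt (hD.mem_nhds hz)
    have d3 := hp1.differentiable one_ne_zero z
    have d4 : dDir ξ (linForm ξ a) z = (N : ℂ) := by
      rw [dDir_linForm, hN]
      push_cast
      refine Finset.sum_congr rfl fun j _ => ?_
      rw [mul_comm, Complex.mul_conj, Complex.normSq_eq_norm_sq]
      push_cast
      rfl
    rw [hu, dbarDir_sub (d2.restrictScalars ℝ) (d3.fun_mul (d1.restrictScalars ℝ)),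
      dbarDir_of_differentiableAt d2, dbarDir_mul d3 (d1.restrictScalars ℝ), dbarDir_conj, d4,
      dbarDir_of_differentiableAt d1, Complex.conj_ofReal]
    ring
  · have h1 : ∫ z in D, ε ^ 2 * (‖u z‖ ^ 2 * w z) ≤ ∫ z in D, (H z - F z +
        (ε ^ 4 * P ^ 4 + ε ^ 2 * κ) * (‖f z‖ ^ 2 * w z)) :=
      setIntegral_mono_on hui' hRi hD.measurableSet hpt
    have hHFi : IntegrableOn (fun z => H z - F z) D := hHi.sub hFi
    rw [integral_const_mul, integral_add hHFi (hfw.const_mul _), integral_sub hHi hFi,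
      integral_const_mul] at h1
    have h2 : ε ^ 2 * ∫ z in D, ‖u z‖ ^ 2 * w z ≤
        ε ^ 2 * ((ε ^ 2 * P ^ 4 + κ) * ∫ z in D, ‖f z‖ ^ 2 * w z) := by
      have : (ε ^ 4 * P ^ 4 + ε ^ 2 * κ) * (∫ z in D, ‖f z‖ ^ 2 * w z) =
        ε ^ 2 * ((ε ^ 2 * P ^ 4 + κ) * ∫ z in D, ‖f z‖ ^ 2 * w z) := by ring
      linarith
    exact le_of_mul_le_mul_left h2 (by positivity)

end Estimate

end

/-! ### Duality with a cut-off, and the limit `ε → 0` -/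

section

open Set Filter Topology Metric ComplexConjugate

variable {n : ℕ}

/-- Stated with continuity on `D` only, because the weights are uncontrolled outside `D`. -/
lemma integrable_of_continuousOn_of_eq_zero {D K : Set (Fin n → ℂ)} {F : (Fin n → ℂ) → ℝ}
    (hF : ContinuousOn F D) (hK : IsCompact K) (hKD : K ⊆ D) (h0 : ∀ z ∉ K, F z = 0) :
    Integrable F := by
  refine (integrableOn_iff_integrable_of_support_subset (s := K) fun z hz => ?_).1
    ((hF.mono hKD).integrableOn_compact hK)
  by_contra h
  exact hz (h0 z h)

section Cutoff

variable {D : Set (Fin n → ℂ)} {φ : (Fin n → ℂ) → ℝ} {f : (Fin n → ℂ) → ℂ}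
  {χ : (Fin n → ℂ) → ℝ}

lemma tsupport_cutoff_mul_subset (χ : (Fin n → ℂ) → ℝ) (f : (Fin n → ℂ) → ℂ) :
    tsupport (fun z => (χ z : ℂ) * f z) ⊆ tsupport χ := by
  refine closure_mono fun z hz h => hz ?_
  simp [h]

lemma contDiff_cutoff_mul (hD : IsOpen D) (hf : DifferentiableOn ℂ f D) (hχ : ContDiff ℝ 2 χ)
    (hs : tsupport χ ⊆ D) : ContDiff ℝ 2 fun z => (χ z : ℂ) * f z := by
  refine contDiff_of_contDiffAt_tsupport fun z hz => ?_
  have hzD := hD.mem_nhds (hs (tsupport_cutoff_mul_subset χ f hz))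
  exact (contDiffAt_ofReal_comp hχ.contDiffAt).mul
    (((contDiffOn_of_differentiableOn hD 2 hf).restrict_scalars ℝ).contDiffAt hzD)

lemma continuousOn_chernDir {Φ : (Fin n → ℂ) → ℝ} {η : (Fin n → ℂ) → ℂ} (hD : IsOpen D)
    (hΦ : ContDiffOn ℝ 2 Φ D) (hη : ContDiff ℝ 2 η) (ξ : Fin n → ℂ) :
    ContinuousOn (chernDir ξ Φ η) D := fun _ hz =>
  (contDiffAt_chernDir (hΦ.contDiffAt (hD.mem_nhds hz)) hη ξ).continuousAt.continuousWithinAt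

/-- Duality: a solution of `∂̄u = ∂̄(p̄ f)` tested against the cut-off of `f`. -/
lemma cutoff_duality (hD : IsOpen D) {Φ : (Fin n → ℂ) → ℝ} (hΦ : ContDiffOn ℝ 2 Φ D)
    (hf : DifferentiableOn ℂ f D) (hχ : ContDiff ℝ 2 χ) (hc : HasCompactSupport χ)
    (hs : tsupport χ ⊆ D) (hχ0 : ∀ z, 0 ≤ χ z) {N s : ℝ} (hN : 0 ≤ N) (hs0 : 0 < s)
    {ξ : Fin n → ℂ} {u : (Fin n → ℂ) → ℂ} (hu : ContDiffOn ℝ 1 u D)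
    (hdu : ∀ z ∈ D, dbarDir ξ u z = -(N : ℂ) * f z)
    (hui : IntegrableOn (fun z => ‖u z‖ ^ 2 * Real.exp (-Φ z)) D) :
    2 * s * (N * ∫ z, χ z * (‖f z‖ ^ 2 * Real.exp (-Φ z))) ≤
      s ^ 2 * (∫ z in D, ‖u z‖ ^ 2 * Real.exp (-Φ z)) +
        ∫ z, ‖chernDir ξ Φ (fun z => (χ z : ℂ) * f z) z‖ ^ 2 * Real.exp (-Φ z) := by
  set η : (Fin n → ℂ) → ℂ := fun z => (χ z : ℂ) * f z with hη
  have hη2 : ContDiff ℝ 2 η := contDiff_cutoff_mul hD hf hχ hs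
  have hηs : tsupport η ⊆ tsupport χ := tsupport_cutoff_mul_subset χ f
  have hηc : HasCompactSupport η := hc.of_isClosed_subset (isClosed_tsupport _) hηs
  have hT := continuousOn_chernDir hD hΦ hη2 ξ
  have hw : ContinuousOn (fun z => Real.exp (-Φ z)) D :=
    Real.continuous_exp.comp_continuousOn hΦ.continuousOn.neg
  have h1 := integral_mul_conj_chernDir hD hΦ hη2 hηc (hηs.trans hs) hu ξ
  have h2 : ∀ z, dbarDir ξ u z * (conj (η z) * (Real.exp (-Φ z) : ℂ)) =
      -((N * (χ z * (‖f z‖ ^ 2 * Real.exp (-Φ z))) : ℝ) : ℂ) := by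
    intro z
    by_cases hz : z ∈ tsupport χ
    · have h3 : f z * conj (f z) = ((‖f z‖ ^ 2 : ℝ) : ℂ) := by
        rw [Complex.mul_conj, Complex.normSq_eq_norm_sq]
      rw [hdu z (hs hz), hη]
      simp only [map_mul, Complex.conj_ofReal]
      calc _ = -((N : ℂ) * (χ z * ((f z * conj (f z)) * (Real.exp (-Φ z) : ℂ)))) := by ring
        _ = _ := by rw [h3]; push_cast; ring
    · simp [hη, image_eq_zero_of_notMem_tsupport hz]
  simp only [h2, integral_neg, neg_neg, integral_complex_ofReal, integral_const_mul] at h1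
  set X : ℝ := ∫ z, χ z * (‖f z‖ ^ 2 * Real.exp (-Φ z)) with hX
  have hX0 : 0 ≤ X := integral_nonneg fun z => mul_nonneg (hχ0 z) (by positivity)
  have hV : Integrable fun z => ‖chernDir ξ Φ η z‖ ^ 2 * Real.exp (-Φ z) :=
    integrable_of_continuousOn_of_eq_zero ((hT.norm.pow 2).mul hw) hc hs fun z hz => by
      rw [chernDir_eq_zero (fun h => hz (hηs h))]; simp
  have hU : Integrable (D.indicator fun z => ‖u z‖ ^ 2 * Real.exp (-Φ z)) :=
    (integrable_indicator_iff hD.measurableSet).2 hui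
  have h4 : N * X ≤ ∫ z, ‖u z * (conj (chernDir ξ Φ η z) * (Real.exp (-Φ z) : ℂ))‖ := by
    have := norm_integral_le_integral_norm
      (fun z => u z * (conj (chernDir ξ Φ η z) * (Real.exp (-Φ z) : ℂ))) (μ := volume)
    rw [h1, Complex.norm_real, Real.norm_of_nonneg (mul_nonneg hN hX0)] at this
    exact this
  have h5 : ∀ z, ‖u z * (conj (chernDir ξ Φ η z) * (Real.exp (-Φ z) : ℂ))‖ ≤
      s / 2 * D.indicator (fun z => ‖u z‖ ^ 2 * Real.exp (-Φ z)) z +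
        1 / (2 * s) * (‖chernDir ξ Φ η z‖ ^ 2 * Real.exp (-Φ z)) := by
    intro z
    by_cases hz : z ∈ D
    · rw [indicator_of_mem hz, norm_mul, norm_mul, RCLike.norm_conj, Complex.norm_real,
        Real.norm_of_nonneg (Real.exp_pos _).le]
      -- Young's inequality with parameter `s`. It is balanced for what follows: the first square
      -- integral is about `N/s` and the second about `sN` times the mass of `f`.
      have h6 : ‖u z‖ * ‖chernDir ξ Φ η z‖ ≤
          s / 2 * ‖u z‖ ^ 2 + 1 / (2 * s) * ‖chernDir ξ Φ η z‖ ^ 2 := by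
        have h7 : s / 2 * ‖u z‖ ^ 2 + 1 / (2 * s) * ‖chernDir ξ Φ η z‖ ^ 2 -
            ‖u z‖ * ‖chernDir ξ Φ η z‖ =
            1 / (2 * s) * (s * ‖u z‖ - ‖chernDir ξ Φ η z‖) ^ 2 := by
          field_simp
          ring
        have h8 : 0 ≤ 1 / (2 * s) * (s * ‖u z‖ - ‖chernDir ξ Φ η z‖) ^ 2 := by positivity
        linarith
      have := mul_le_mul_of_nonneg_right h6 (Real.exp_pos (-Φ z)).le
      linarith
    · rw [indicator_of_notMem hz, chernDir_eq_zero fun h => hz (hs (hηs h))]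
      simp
  have h6 := integral_mono_of_nonneg (Eventually.of_forall fun z => norm_nonneg _)
    ((hU.const_mul (s / 2)).add (hV.const_mul (1 / (2 * s)))) (Eventually.of_forall h5)
  simp only [Pi.add_apply] at h6
  rw [integral_add (hU.const_mul (s / 2)) (hV.const_mul (1 / (2 * s))), integral_const_mul,
    integral_const_mul, integral_indicator hD.measurableSet] at h6
  have h7 := mul_le_mul_of_nonneg_left (h4.trans h6) (by positivity : 0 ≤ 2 * s)
  refine h7.trans (le_of_eq ?_)
  field_simp

/-- The limiting inequality with quadratic weight of strength `s`. -/
lemma levi_inequality (hD : IsOpen D) (hφ : ContDiffOn ℝ 2 φ D) (hf : f ∈ bergmanSpace D φ)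
    (hdiv : IsL2Divisible D φ f) (hχ : ContDiff ℝ 2 χ) (hc : HasCompactSupport χ)
    (hsupp : tsupport χ ⊆ D) (hχ0 : ∀ z, 0 ≤ χ z) (hχ1 : ∀ z, χ z ≤ 1)
    {ξ a : Fin n → ℂ} {c s P : ℝ} (hP : ∀ z ∈ D, ‖linForm ξ a z‖ ≤ P) (hs : 0 < s)
    (hcs : c ≤ s * ∑ j, ‖ξ j‖ ^ 2) (hL : ∀ z ∈ tsupport χ, leviForm φ z ξ ≤ -c) :
    (s * (∑ j, ‖ξ j‖ ^ 2) + c) *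
        (∫ z, χ z * (‖f z‖ ^ 2 * Real.exp (-(φ z + quadWeight s a z)))) ≤
      s * (∑ j, ‖ξ j‖ ^ 2) * (∫ z in D, ‖f z‖ ^ 2 * Real.exp (-(φ z + quadWeight s a z))) +
        ∫ z, ‖dbarDir ξ (fun z => (χ z : ℂ) * f z) z‖ ^ 2 *
          Real.exp (-(φ z + quadWeight s a z)) := by
  set N : ℝ := ∑ j, ‖ξ j‖ ^ 2 with hN
  have hN0 : 0 ≤ N := by positivity
  set Φ : (Fin n → ℂ) → ℝ := fun z => φ z + quadWeight s a z with hΦdef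
  have hΦ : ContDiffOn ℝ 2 Φ D := hφ.add (contDiff_quadWeight s a).contDiffOn
  set η : (Fin n → ℂ) → ℂ := fun z => (χ z : ℂ) * f z with hη
  have hη2 : ContDiff ℝ 2 η := contDiff_cutoff_mul hD hf.1 hχ hsupp
  have hηs : tsupport η ⊆ tsupport χ := tsupport_cutoff_mul_subset χ f
  have hηc : HasCompactSupport η := hc.of_isClosed_subset (isClosed_tsupport _) hηs
  have hw : ContinuousOn (fun z => Real.exp (-Φ z)) D :=
    Real.continuous_exp.comp_continuousOn hΦ.continuousOn.neg
  have hBK := bochnerKodaira hD hΦ hη2 hηc (hηs.trans hsupp) ξ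
  set X : ℝ := ∫ z, χ z * (‖f z‖ ^ 2 * Real.exp (-Φ z)) with hX
  set A : ℝ := ∫ z in D, ‖f z‖ ^ 2 * Real.exp (-Φ z) with hA
  set V : ℝ := ∫ z, ‖chernDir ξ Φ η z‖ ^ 2 * Real.exp (-Φ z) with hV
  have hε : ∀ᶠ ε in 𝓝[>] (0 : ℝ), 2 * s * (N * X) ≤
      s ^ 2 * ((ε ^ 2 * P ^ 4 + N / (s - ε ^ 2 * N)) * A) + V := by
    have hlt : ∀ᶠ ε in 𝓝 (0 : ℝ), ε ^ 2 * N < s := by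
      have : ContinuousAt (fun ε : ℝ => ε ^ 2 * N) 0 := by fun_prop
      exact this.eventually_lt_const (by simpa using hs)
    filter_upwards [self_mem_nhdsWithin, nhdsWithin_le_nhds hlt] with ε hε0 hεs
    obtain ⟨u, hu1, hu2, hu3, hu4⟩ :=
      exists_dbar_solution hD hφ.continuousOn hf hdiv (a := a) hε0 hεs hP
    refine (cutoff_duality hD hΦ hf.1 hχ hc hsupp hχ0 hN0 hs hu1 hu2 hu3).trans ?_
    have := mul_le_mul_of_nonneg_left hu4 (sq_nonneg s)
    linarith
  -- In the limit the constant of the solution becomes `N/s`, and `s² · N/s = sN`.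
  have hlim : 2 * s * (N * X) ≤ s * N * A + V := by
    refine ge_of_tendsto (x := 𝓝[>] (0 : ℝ)) ?_ hε
    have hca : ContinuousAt (fun ε : ℝ =>
        s ^ 2 * ((ε ^ 2 * P ^ 4 + N / (s - ε ^ 2 * N)) * A) + V) 0 := by
      have h1 : ContinuousAt (fun ε : ℝ => N / (s - ε ^ 2 * N)) 0 :=
        continuousAt_const.div (by fun_prop) (by simpa using hs.ne')
      have h2 : ContinuousAt (fun ε : ℝ => ε ^ 2 * P ^ 4) 0 := by fun_prop
      exact (continuousAt_const.mul ((h2.add h1).mul continuousAt_const)).add continuousAt_const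
    have h3 : s ^ 2 * (((0 : ℝ) ^ 2 * P ^ 4 + N / (s - 0 ^ 2 * N)) * A) + V = s * N * A + V := by
      simp only [ne_eq, OfNat.ofNat_ne_zero, not_false_eq_true, zero_pow, zero_mul, sub_zero,
        zero_add]
      field_simp
    rw [← h3]
    exact hca.tendsto.mono_left nhdsWithin_le_nhds
  have hlevi : ∫ z, leviForm Φ z ξ * (‖η z‖ ^ 2 * Real.exp (-Φ z)) ≤ (s * N - c) * X := by
    rw [hX, ← integral_const_mul]
    have hz0 : ∀ z ∉ tsupport χ, χ z = 0 := fun z hz => image_eq_zero_of_notMem_tsupport hz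
    have hLc : ContinuousOn (fun z => leviForm Φ z ξ) D := by
      have h := (contDiffOn_fderiv hD hΦ).continuousOn_fderiv_of_isOpen hD le_rfl
      exact continuousOn_const.mul (((h.clm_apply continuousOn_const).clm_apply
        continuousOn_const).add ((h.clm_apply continuousOn_const).clm_apply continuousOn_const))
    refine integral_mono ?_ ?_ fun z => ?_
    · exact integrable_of_continuousOn_of_eq_zero
        (hLc.mul ((hη2.continuous.norm.pow 2).continuousOn.mul hw)) hc hsupp fun z hz => by
          simp [hη, hz0 z hz]
    · exact integrable_of_continuousOn_of_eq_zero (continuousOn_const.mul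
        (hχ.continuous.continuousOn.mul ((hf.1.continuousOn.norm.pow 2).mul hw))) hc hsupp
        fun z hz => by simp [hz0 z hz]
    · by_cases hz : z ∈ tsupport χ
      · have h1 : leviForm Φ z ξ ≤ s * N - c := by
          rw [hΦdef, leviForm_add (hφ.contDiffAt (hD.mem_nhds (hsupp hz)))
            (contDiff_quadWeight s a).contDiffAt, leviForm_quadWeight]
          linarith [hL z hz]
        -- `χ² ≤ χ` as `0 ≤ χ ≤ 1`. Multiplying this by `sN - c` preserves the inequality only
        -- because `c ≤ sN`.
        have h2 : ‖η z‖ ^ 2 * Real.exp (-Φ z) ≤ χ z * (‖f z‖ ^ 2 * Real.exp (-Φ z)) := by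
          rw [hη, ← mul_assoc]
          refine mul_le_mul_of_nonneg_right ?_ (Real.exp_pos _).le
          simp only [norm_mul, mul_pow, Complex.norm_real, Real.norm_eq_abs, sq_abs]
          refine mul_le_mul_of_nonneg_right ?_ (by positivity)
          nlinarith [hχ0 z, hχ1 z]
        exact (mul_le_mul_of_nonneg_right h1 (by positivity)).trans
          (mul_le_mul_of_nonneg_left h2 (by linarith))
      · simp [hη, hz0 z hz]
  rw [hBK] at hlim
  linarith

end Cutoff

/-! ### Bounds for the weight and exponential growth -/

section Asymptotics

/-- The ambient norm is the sup norm while the weight is Euclidean, hence the factor `n`. -/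
lemma quadWeight_le {s δ : ℝ} (hs : 0 ≤ s) {a z : Fin n → ℂ} (hz : ‖z - a‖ ≤ δ) :
    quadWeight s a z ≤ s * (n * δ ^ 2) := by
  refine mul_le_mul_of_nonneg_left ?_ hs
  have : ∀ j ∈ Finset.univ, ‖z j - a j‖ ^ 2 ≤ δ ^ 2 := fun j _ =>
    pow_le_pow_left₀ (norm_nonneg _) ((norm_le_pi_norm (z - a) j).trans hz) 2
  simpa using Finset.sum_le_sum this

lemma le_quadWeight {s r : ℝ} (hs : 0 ≤ s) (hr : 0 < r) {a z : Fin n → ℂ} (hz : r ≤ ‖z - a‖) :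
    s * r ^ 2 ≤ quadWeight s a z := by
  refine mul_le_mul_of_nonneg_left ?_ hs
  obtain ⟨j, hj⟩ : ∃ j, r ≤ ‖z j - a j‖ := by
    by_contra! h
    exact absurd ((pi_norm_lt_iff hr).2 h) (not_lt.2 hz)
  exact (pow_le_pow_left₀ hr.le hj 2).trans
    (Finset.single_le_sum (f := fun j => ‖z j - a j‖ ^ 2) (fun _ _ => by positivity)
      (Finset.mem_univ j))

/-- Only `e^{sy} ≥ (sy)²/2` is used. For `s ≥ 1` the linear side is at most `(β + γ)s`, which the
quadratic exceeds once `s > (β + γ)/(αy²/2)`. -/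
lemma exists_linear_lt_exp {α β γ y : ℝ} (hα : 0 < α) (hβ : 0 ≤ β) (hγ : 0 ≤ γ) (hy : 0 < y)
    (s₀ : ℝ) : ∃ s, s₀ ≤ s ∧ 0 < s ∧ s * β + γ < α * Real.exp (s * y) := by
  have hk : 0 < α * y ^ 2 / 2 := by positivity
  refine ⟨(β + γ) / (α * y ^ 2 / 2) + |s₀| + 1, ?_, by positivity, ?_⟩
  · have : 0 ≤ (β + γ) / (α * y ^ 2 / 2) := by positivity
    linarith [le_abs_self s₀]
  · set s := (β + γ) / (α * y ^ 2 / 2) + |s₀| + 1 with hs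
    have h0 : 0 ≤ (β + γ) / (α * y ^ 2 / 2) := by positivity
    have h1 : 1 ≤ s := by linarith [abs_nonneg s₀]
    have h2 : β + γ < α * y ^ 2 / 2 * s := by
      have : (β + γ) / (α * y ^ 2 / 2) < s := by linarith [abs_nonneg s₀]
      rw [div_lt_iff₀ hk] at this
      linarith
    have h3 : (s * y) ^ 2 / 2 ≤ Real.exp (s * y) := by
      have := Real.quadratic_le_exp_of_nonneg (x := s * y) (by positivity)
      have : 0 ≤ s * y := by positivity
      linarith
    have h4 := mul_le_mul_of_nonneg_left h3 hα.le
    have h5 : (β + γ) * s < (α * y ^ 2 / 2 * s) * s := mul_lt_mul_of_pos_right h2 (by linarith)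
    have h6 : s * β + γ ≤ (β + γ) * s := by nlinarith
    have h7 : (α * y ^ 2 / 2 * s) * s = α * ((s * y) ^ 2 / 2) := by ring
    linarith

end Asymptotics

end

/-! ### Concentration at a point of negative Levi form -/

section

open Set Filter Topology Metric ComplexConjugate

section NegativeLevi

variable {n : ℕ} {D : Set (Fin n → ℂ)} {φ : (Fin n → ℂ) → ℝ} {f : (Fin n → ℂ) → ℂ}

/-- A non-zero holomorphic function has positive weighted mass on every ball. -/
lemma setIntegral_ball_pos (hD : IsDomainIn D) (hφ : ContinuousOn φ D)
    (hf : f ∈ bergmanSpace D φ) (hne : ∃ z ∈ D, f z ≠ 0) {a : Fin n → ℂ} {δ : ℝ} (hδ : 0 < δ)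
    (hball : ball a δ ⊆ D) : 0 < ∫ z in ball a δ, ‖f z‖ ^ 2 * Real.exp (-φ z) := by
  rw [setIntegral_pos_iff_support_of_nonneg_ae (Eventually.of_forall fun z => by positivity)
    ((integrableOn_of_mem_bergmanSpace hD.1 hφ hf).mono_set hball)]
  have hopen : IsOpen (ball a δ ∩ f ⁻¹' {0}ᶜ) :=
    (hf.1.continuousOn.mono hball).isOpen_inter_preimage isOpen_ball isClosed_singleton.isOpen_compl
  have hnon : (ball a δ ∩ f ⁻¹' {0}ᶜ).Nonempty := by
    by_contra h
    obtain ⟨z, hz, hfz⟩ := hne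
    refine hfz (eqOn_zero_of_eventuallyEq_zero hD.1 hD.2.isPreconnected hf.1
      (hball (mem_ball_self hδ)) ?_ z hz)
    filter_upwards [ball_mem_nhds a hδ] with y hy
    by_contra hy0
    exact h ⟨y, hy, hy0⟩
  refine (hopen.measure_pos volume hnon).trans_le (measure_mono fun z hz => ⟨?_, hz.1⟩)
  have hz0 : f z ≠ 0 := hz.2
  have : 0 < ‖f z‖ ^ 2 * Real.exp (-φ z) := by positivity
  exact this.ne'

/-- Localization of the limiting inequality at a point near which the Levi form is negative. -/
lemma exp_bound_of_leviForm_neg (hD : IsOpen D) (hφ : ContDiffOn ℝ 2 φ D)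
    (hf : f ∈ bergmanSpace D φ) (hdiv : IsL2Divisible D φ f) {ξ a : Fin n → ℂ} {c P r : ℝ}
    (hc : 0 < c) (hP : ∀ z ∈ D, ‖linForm ξ a z‖ ≤ P) (hr : 0 < r)
    (hball : closedBall a (2 * r) ⊆ D) (hL : ∀ z ∈ closedBall a (2 * r), leviForm φ z ξ ≤ -c) :
    ∃ C, 0 ≤ C ∧ ∀ s, 0 < s → c ≤ s * ∑ j, ‖ξ j‖ ^ 2 →
      c * (∫ z in ball a (r / (n + 1)), ‖f z‖ ^ 2 * Real.exp (-φ z)) * Real.exp (s * (r ^ 2 / 2)) ≤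
        s * ((∑ j, ‖ξ j‖ ^ 2) * ∫ z in D, ‖f z‖ ^ 2 * Real.exp (-φ z)) + C := by
  let χ : ContDiffBump a := ⟨r, 2 * r, hr, by linarith⟩
  have hχ : ContDiff ℝ 2 χ := χ.contDiff
  have hχc : HasCompactSupport χ := χ.hasCompactSupport
  have hχs : tsupport χ = closedBall a (2 * r) := χ.tsupport_eq
  have hsupp : tsupport χ ⊆ D := hχs ▸ hball
  have hχ1 : ∀ z ∈ closedBall a r, χ z = 1 := fun z hz => χ.one_of_mem_closedBall hz
  set η : (Fin n → ℂ) → ℂ := fun z => (χ z : ℂ) * f z with hη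
  have hη2 : ContDiff ℝ 2 η := contDiff_cutoff_mul hD hf.1 hχ hsupp
  have hηs : tsupport η ⊆ tsupport χ := tsupport_cutoff_mul_subset χ f
  have hdη : Continuous (dbarDir ξ η) := continuous_iff_continuousAt.2 fun z =>
    continuousAt_dbarDir (hη2.contDiffAt.of_le (by norm_num)) ξ
  have hdη0 : ∀ z ∈ ball a r, dbarDir ξ η z = 0 := by
    intro z hz
    have h1 : η =ᶠ[𝓝 z] f := by
      filter_upwards [isOpen_ball.mem_nhds hz] with y hy
      rw [hη]
      simp [hχ1 y (ball_subset_closedBall hy)]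
    have hzD : z ∈ D := hball (ball_subset_closedBall (ball_subset_ball (by linarith) hz))
    rw [dbarDir, h1.fderiv_eq]
    exact dbarDir_of_differentiableAt (hf.1.differentiableAt (hD.mem_nhds hzD))
  have hexp : ContinuousOn (fun z => Real.exp (-φ z)) D :=
    Real.continuous_exp.comp_continuousOn hφ.continuousOn.neg
  have hC : Integrable fun z => ‖dbarDir ξ η z‖ ^ 2 * Real.exp (-φ z) :=
    integrable_of_continuousOn_of_eq_zero ((hdη.norm.pow 2).continuousOn.mul hexp) hχc hsupp
      fun z hz => by simp [(eq_zero_of_notMem_tsupport (fun h => hz (hηs h)) ξ).2.2]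
  refine ⟨∫ z, ‖dbarDir ξ η z‖ ^ 2 * Real.exp (-φ z),
    integral_nonneg fun z => by positivity, fun s hs hcs => ?_⟩
  have hmain := levi_inequality hD hφ hf hdiv hχ hχc hsupp (fun z => χ.nonneg) (fun z => χ.le_one)
    (a := a) hP hs hcs fun z hz => hL z (hχs ▸ hz)
  set N : ℝ := ∑ j, ‖ξ j‖ ^ 2 with hN
  have hN0 : 0 ≤ N := by positivity
  set F : (Fin n → ℂ) → ℝ := fun z => ‖f z‖ ^ 2 * Real.exp (-φ z) with hF
  set W : (Fin n → ℂ) → ℝ := fun z => ‖f z‖ ^ 2 * Real.exp (-(φ z + quadWeight s a z)) with hW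
  have hF0 : ∀ z, 0 ≤ F z := fun z => by positivity
  have hW0 : ∀ z, 0 ≤ W z := fun z => by positivity
  have hWF : ∀ z, W z = Real.exp (-quadWeight s a z) * F z := fun z => by
    simp only [hW, hF, neg_add, Real.exp_add]
    ring
  have hFi : IntegrableOn F D := integrableOn_of_mem_bergmanSpace hD hφ.continuousOn hf
  have hWi : IntegrableOn W D := integrableOn_add_quadWeight hD hφ.continuousOn hf hs.le a
  have hχW : Integrable fun z => χ z * W z :=
    integrable_of_continuousOn_of_eq_zero (hχ.continuous.continuousOn.mul
      (continuousOn_norm_sq_mul_exp hf.1.continuousOn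
        (continuousOn_add_quadWeight hφ.continuousOn s a))) hχc hsupp
      fun z hz => by simp [image_eq_zero_of_notMem_tsupport hz]
  have hXD : ∫ z, χ z * W z = ∫ z in D, χ z * W z :=
    (setIntegral_eq_integral_of_forall_compl_eq_zero fun z hz => by
      simp [image_eq_zero_of_notMem_tsupport fun h => hz (hsupp h)]).symm
  have hfar : ∀ z, z ∉ ball a r → Real.exp (-quadWeight s a z) ≤ Real.exp (-(s * r ^ 2)) := by
    intro z hz
    rw [mem_ball, not_lt, dist_eq_norm] at hz
    exact Real.exp_le_exp.2 (neg_le_neg (le_quadWeight hs.le hr hz))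
  -- The integrand `(1 - χ)W` vanishes on the ball of radius `r`, and outside it the weight costs a
  -- factor `e^{-sr²}`. The same reasoning applies to `∂̄_ξ η` in `hE`, because `η = f` is
  -- holomorphic on that ball.
  have hdiff : (∫ z in D, W z) - ∫ z, χ z * W z ≤ Real.exp (-(s * r ^ 2)) * ∫ z in D, F z := by
    rw [hXD, ← integral_sub hWi hχW.integrableOn, ← integral_const_mul]
    refine setIntegral_mono_on (hWi.sub hχW.integrableOn) (hFi.const_mul _) hD.measurableSet
      fun z _ => ?_
    by_cases hz : z ∈ ball a r
    · rw [hχ1 z (ball_subset_closedBall hz), one_mul, sub_self]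
      exact mul_nonneg (Real.exp_pos _).le (hF0 z)
    · have h1 : 0 ≤ χ z * W z := mul_nonneg χ.nonneg (hW0 z)
      have h2 := mul_le_mul_of_nonneg_right (hfar z hz) (hF0 z)
      rw [← hWF] at h2
      linarith
  have hE : ∫ z, ‖dbarDir ξ η z‖ ^ 2 * Real.exp (-(φ z + quadWeight s a z)) ≤
      Real.exp (-(s * r ^ 2)) * ∫ z, ‖dbarDir ξ η z‖ ^ 2 * Real.exp (-φ z) := by
    rw [← integral_const_mul]
    refine integral_mono_of_nonneg (Eventually.of_forall fun z => by positivity) (hC.const_mul _)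
      (Eventually.of_forall fun z => ?_)
    by_cases hz : z ∈ ball a r
    · simp [hdη0 z hz]
    · have h2 := mul_le_mul_of_nonneg_right (hfar z hz)
        (by positivity : 0 ≤ ‖dbarDir ξ η z‖ ^ 2 * Real.exp (-φ z))
      refine le_trans (le_of_eq ?_) h2
      simp only [neg_add, Real.exp_add]
      ring
  -- On the ball of radius `r/(n + 1)` the quadratic weight is at most `s n r²/(n + 1)² ≤ s r²/2`.
  -- The mass near `a` thus decays at half the exponential rate of the error terms.
  have hδ : r / (n + 1) ≤ r := div_le_self hr.le (by linarith [n.cast_nonneg (α := ℝ)])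
  have hbD : ball a (r / (n + 1)) ⊆ D := fun z hz =>
    hball (ball_subset_closedBall (ball_subset_ball (by linarith) hz))
  have hX : Real.exp (-(s * (r ^ 2 / 2))) * ∫ z in ball a (r / (n + 1)), F z ≤
      ∫ z, χ z * W z := by
    rw [← integral_const_mul]
    refine (setIntegral_mono_on ((hFi.mono_set hbD).const_mul _) hχW.integrableOn
      measurableSet_ball fun z hz => ?_).trans (setIntegral_le_integral hχW
        (Eventually.of_forall fun z => mul_nonneg χ.nonneg (hW0 z)))
    rw [hχ1 z (ball_subset_closedBall (ball_subset_ball hδ hz)), one_mul, hWF]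
    refine mul_le_mul_of_nonneg_right (Real.exp_le_exp.2 (neg_le_neg ?_)) (hF0 z)
    rw [mem_ball, dist_eq_norm] at hz
    refine (quadWeight_le hs.le hz.le).trans (mul_le_mul_of_nonneg_left ?_ hs.le)
    have hn : (0 : ℝ) ≤ n := n.cast_nonneg
    rw [div_pow, mul_div_assoc', div_le_div_iff₀ (by positivity) (by norm_num)]
    nlinarith [sq_nonneg r, mul_nonneg (sq_nonneg r) (sq_nonneg (n : ℝ)), mul_nonneg (sq_nonneg r) hn]
  set X : ℝ := ∫ z, χ z * W z with hXdef
  have h1 : c * X ≤ Real.exp (-(s * r ^ 2)) * (s * (N * ∫ z in D, F z) +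
      ∫ z, ‖dbarDir ξ η z‖ ^ 2 * Real.exp (-φ z)) := by
    have h2 := mul_le_mul_of_nonneg_left hdiff (mul_nonneg hs.le hN0)
    linarith
  have h2 := (mul_le_mul_of_nonneg_left hX hc.le).trans h1
  -- Multiplying by `e^{sr²}` clears the decay on the right and leaves `e^{sr²/2}` on the left.
  have h3 := mul_le_mul_of_nonneg_left h2 (Real.exp_pos (s * r ^ 2)).le
  have e1 : Real.exp (s * r ^ 2) * Real.exp (-(s * r ^ 2)) = 1 := by
    rw [← Real.exp_add]; simp
  have e2 : Real.exp (s * r ^ 2) * Real.exp (-(s * (r ^ 2 / 2))) = Real.exp (s * (r ^ 2 / 2)) := by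
    rw [← Real.exp_add]; congr 1; ring
  calc _ = c * (∫ z in ball a (r / (n + 1)), F z) *
        (Real.exp (s * r ^ 2) * Real.exp (-(s * (r ^ 2 / 2)))) := by rw [e2]
    _ = Real.exp (s * r ^ 2) * (c * (Real.exp (-(s * (r ^ 2 / 2))) *
        ∫ z in ball a (r / (n + 1)), F z)) := by ring
    _ ≤ _ := h3
    _ = _ := by rw [← mul_assoc, e1, one_mul]

end NegativeLevi

end

end SkodaDivision

theorem mainTheorem2 (n : ℕ) (D : Set (Fin n → ℂ)) (hD : SkodaDivision.IsDomainIn D)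
    (hDb : Bornology.IsBounded D) (φ : (Fin n → ℂ) → ℝ) (hφ : ContDiffOn ℝ 2 φ D)
    (hdiv : ∃ f ∈ SkodaDivision.bergmanSpace D φ, (∃ z ∈ D, f z ≠ 0) ∧
      SkodaDivision.IsL2Divisible D φ f) :
    SkodaDivision.IsPSH D φ := by
  obtain ⟨f, hf, hne, hdiv⟩ := hdiv
  refine SkodaDivision.isPSH_of_leviForm_nonneg hD.1 hφ fun a ha ξ => ?_
  by_contra! hneg
  -- Half of the negative value, so that by continuity the bound `-c` persists on a small ball
  -- around `a`.
  set c : ℝ := -SkodaDivision.leviForm φ a ξ / 2 with hc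
  have hc0 : 0 < c := by linarith
  have hN : 0 < ∑ j, ‖ξ j‖ ^ 2 := by
    have hξ : ξ ≠ 0 := by
      rintro rfl
      simp [SkodaDivision.leviForm] at hneg
    obtain ⟨j, hj⟩ := Function.ne_iff.1 hξ
    refine Finset.sum_pos' (fun _ _ => by positivity) ⟨j, Finset.mem_univ j, ?_⟩
    have : ξ j ≠ 0 := hj
    positivity
  -- Boundedness of `D` bounds the linear form `p`, hence the `ε⁴|p|⁴` error uniformly.
  obtain ⟨P, hP⟩ := hDb.isCompact_closure.exists_bound_of_continuousOn
    (f := SkodaDivision.linForm ξ a) (SkodaDivision.differentiable_linForm ξ a).continuous.continuousOn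
  have hLc : ContinuousAt (fun z => SkodaDivision.leviForm φ z ξ) a := by
    have h := ((SkodaDivision.contDiffOn_fderiv hD.1 hφ).continuousOn_fderiv_of_isOpen hD.1
      le_rfl).continuousAt (hD.1.mem_nhds ha)
    exact continuousAt_const.mul (((h.clm_apply continuousAt_const).clm_apply
      continuousAt_const).add ((h.clm_apply continuousAt_const).clm_apply continuousAt_const))
  obtain ⟨R, hR, hRb⟩ := Metric.nhds_basis_closedBall.mem_iff.1
    (Filter.inter_mem (hD.1.mem_nhds ha)
      (hLc.eventually_lt_const (by linarith : SkodaDivision.leviForm φ a ξ < -c)))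
  obtain ⟨r, hr, rfl⟩ : ∃ r > 0, R = 2 * r := ⟨R / 2, by positivity, by ring⟩
  obtain ⟨C, hC, hbound⟩ := SkodaDivision.exp_bound_of_leviForm_neg hD.1 hφ hf hdiv hc0
    (fun z hz => hP z (subset_closure hz)) hr (fun z hz => (hRb hz).1)
    (fun z hz => le_of_lt (hRb hz).2)
  have hpos : 0 < ∫ z in Metric.ball a (r / (n + 1)), ‖f z‖ ^ 2 * Real.exp (-φ z) := by
    refine SkodaDivision.setIntegral_ball_pos hD hφ.continuousOn hf hne (by positivity) fun z hz => (hRb ?_).1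
    refine Metric.ball_subset_closedBall (Metric.ball_subset_ball ?_ hz)
    have : r / (n + 1) ≤ r := div_le_self hr.le (by linarith [n.cast_nonneg (α := ℝ)])
    linarith
  have hA : 0 ≤ ∫ z in D, ‖f z‖ ^ 2 * Real.exp (-φ z) := integral_nonneg fun z => by positivity
  -- The lower bound `c / N` on `s` secures `c ≤ sN`.
  obtain ⟨s, hs0, hs, hlt⟩ := SkodaDivision.exists_linear_lt_exp (mul_pos hc0 hpos) (mul_nonneg hN.le hA) hC
    (by positivity : 0 < r ^ 2 / 2) (c / ∑ j, ‖ξ j‖ ^ 2)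
  exact absurd (hbound s hs ((div_le_iff₀ hN).1 hs0)) (not_le.2 hlt)
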